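/- Let $n,k$ be integers with $1\le k\le n$, let $1\le p\le \frac nk$, $1\le q\le\infty$, and define $\bar p\in[1,\infty]$ by $\frac1{\bar p}=\frac1p-\frac kn$. Assume that either (i) $k<n$ and ($p>1$ or $p=q=1$), or (ii) $k=n$ and $p=q=1$. Then there is a finite constant $c=c_{n,k}(p,q)$ such that for all real-valued $f\in C_0^\infty(\mathbb R^n)$ (smooth functions with compact support) $$\|f\|_{L(\bar p,q)}\le c\,\big\|\,|D^kf|\,\big\|_{L(p,q)},$$ where $|D^kf|$ is the Euclidean length of the vector of all partial derivatives $\partial_{i_1}\cdots\partial_{i_k}f$, $1\le i_1,\dots,i_k\le n$, of order $k$. In particular, if $p=\frac nk$ and $q=1$, then also $\|f\|_{L^\infty}\le c\,\|\,|D^kf|\,\|_{L(n/k,1)}$ for all $f\in C_0^\infty(\mathbb R^n)$. Here $f^*(t)=\inf\{s\ge 0: |\{x:|f(x)|>s\}|\le t\}$ is the decreasing rearrangement with respect to Lebesgue measure, $f^{**}(t)=\frac1t\int_0^t f^*(s)\,ds$, and $$\|f\|_{L(p,q)}=\Big\{\int_0^\infty\big(f^*(t)t^{1/p}\big)^q\frac{dt}t\Big\}^{1/q}\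 (1\le p<\infty),\qquad \|f\|_{L(\infty,q)}=\Big\{\int_0^\infty\big(f^{**}(t)-f^*(t)\big)^q\frac{dt}t\Big\}^{1/q},$$ where for $q=\infty$ the expression $\{\int_0^\infty \varphi(t)^q\frac{dt}t\}^{1/q}$ is read as $\sup_{t>0}\varphi(t)$. -/

import Mathlib

open MeasureTheory Set
open scoped ENNReal NNReal ContDiff

noncomputable section

/-- The decreasing rearrangement `f^*(t) = inf {s ≥ 0 : μ {|f| > s} ≤ t}` of `f`
(the infimum of the empty set of real numbers `s` being `∞`). -/
def decRearr {α : Type*} [MeasurableSpace α] (μ : Measure α) (f : α → ℝ) (t : ℝ) : ℝ≥0∞ :=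
  sInf {s : ℝ≥0∞ | μ {x | s < ‖f x‖ₑ} ≤ ENNReal.ofReal t}

/-- The maximal average `f^{**}(t) = (1/t) ∫_0^t f^*(s) ds`. -/
def decRearrAvg {α : Type*} [MeasurableSpace α] (μ : Measure α) (f : α → ℝ) (t : ℝ) : ℝ≥0∞ :=
  (∫⁻ s in Ioc 0 t, decRearr μ f s) / ENNReal.ofReal t

/-- `(∫_0^∞ φ(t)^q dt/t)^{1/q}` for `q < ∞`, and `sup_{t > 0} φ(t)` for `q = ∞`. -/
def haarNorm (q : ℝ≥0∞) (φ : ℝ → ℝ≥0∞) : ℝ≥0∞ :=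
  if q = ⊤ then ⨆ t ∈ Ioi (0 : ℝ), φ t
  else (∫⁻ t in Ioi (0 : ℝ), φ t ^ q.toReal * ENNReal.ofReal t⁻¹) ^ (1 / q.toReal)

/-- The Lorentz functional `‖f‖_{L(p,q)}`, built on `f^*(t) t^{1/p}` for `p < ∞` and on the
oscillation `f^{**}(t) - f^*(t)` for `p = ∞`. -/
def lorentzNorm {α : Type*} [MeasurableSpace α] (μ : Measure α) (p q : ℝ≥0∞) (f : α → ℝ) :
    ℝ≥0∞ :=
  if p = ⊤ then haarNorm q (fun t => decRearrAvg μ f t - decRearr μ f t)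
  else haarNorm q (fun t => decRearr μ f t * ENNReal.ofReal (t ^ (1 / p.toReal)))

/-- `|D^k f|(x)`: the Euclidean length of the vector of all partial derivatives
`∂_{i_1} ⋯ ∂_{i_k} f(x)` of order `k`. -/
def derivLength {n : ℕ} (k : ℕ) (f : EuclideanSpace ℝ (Fin n) → ℝ)
    (x : EuclideanSpace ℝ (Fin n)) : ℝ :=
  √(∑ i : Fin k → Fin n,
    (iteratedFDeriv ℝ k f x (fun j => EuclideanSpace.single (i j) (1 : ℝ))) ^ 2)

end

open MeasureTheory Set
open scoped ENNReal NNReal ContDiff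

/-! ### The decreasing rearrangement and the distribution function -/

/-! Everything rests on the Gagliardo–Nirenberg inequality $\|g\|_{n/(n-1)}\le C\|\nabla g\|_1$,
$n\ge2$, applied to truncations of $f$. Cutting $f$ at height $f^*(t)$ and using Hölder and
Hardy–Littlewood on a set of measure at most $t$ gives $f^{**}-f^*\le C\,t^{1/n}|\nabla f|^{**}$
(`oscillation_le`).

Hardy's averaging inequality, valid for $1/p<1$, replaces $|\nabla f|^{**}$ by $|\nabla f|^*$; at
$p=n$ this is already the $L(\infty,q)$ estimate. For $1<p<n$ one also writes
$f^{**}(t)=\int_t^\infty(f^{**}-f^*)\,ds/s$ and uses Hardy's tail inequality. Averaging fails at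
$p=1$; for $p=q=1$, truncation to the layers $u<|f|<2u$ and integration in $u$ bound
$\int|\{|f|>u\}|^{(n-1)/n}du$ by $\int|\nabla f|$ (`lintegral_superlevel_rpow_le`). In dimension one
the fundamental theorem of calculus suffices.

For higher order, the order $k$ estimate applied to each $\partial_i f$ controls $|\nabla f|$, and a
first order inequality gains one more step. If $p=n/k$, the first $k-1$ steps are subcritical and
end in $L(n,q)$; the last is the oscillation estimate. By Fubini the $L(\infty,1)$ functional is the
supremum norm (`haarNorm_one_oscillation`). -/

/-- The distribution function `u ↦ μ {u < |f|}`. -/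
noncomputable def superlevel {α : Type*} [MeasurableSpace α] (μ : Measure α) (f : α → ℝ)
    (u : ℝ≥0∞) : ℝ≥0∞ :=
  μ {x | u < ‖f x‖ₑ}

section Rearrangement

variable {α : Type*} [MeasurableSpace α] {μ : Measure α} {f g : α → ℝ}

lemma superlevel_antitone : Antitone (superlevel μ f) := fun _ _ h =>
  measure_mono fun _ hx => lt_of_le_of_lt h hx

lemma superlevel_mono (h : ∀ x, ‖f x‖ₑ ≤ ‖g x‖ₑ) (u : ℝ≥0∞) :
    superlevel μ f u ≤ superlevel μ g u :=
  measure_mono fun x hx => lt_of_lt_of_le hx (h x)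

lemma measurable_superlevel_ofReal : Measurable fun u : ℝ => superlevel μ f (ENNReal.ofReal u) :=
  (superlevel_antitone.comp_monotone ENNReal.ofReal_mono).measurable

/-- Continuity of `μ` from below makes the distribution function right-continuous, so the infimum
defining $f^*$ is attained. This inverse relation is the only access to $f^*$ used later. -/
lemma decRearr_le_iff {t : ℝ} {u : ℝ≥0∞} :
    decRearr μ f t ≤ u ↔ superlevel μ f u ≤ ENNReal.ofReal t := by
  refine ⟨fun h => ?_, fun h => sInf_le h⟩
  rcases eq_or_ne u ⊤ with rfl | hu
  · simp [superlevel]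
  obtain ⟨v, hv, hvu, hlim⟩ := exists_seq_strictAnti_tendsto' (lt_top_iff_ne_top.2 hu)
  have hset : {x | u < ‖f x‖ₑ} = ⋃ n, {x | v n < ‖f x‖ₑ} := by
    ext x
    simp only [mem_ofPred_eq, mem_iUnion]
    exact ⟨fun hx => ((hlim.eventually_lt_const hx).exists),
      fun ⟨n, hn⟩ => (hvu n).1.trans hn⟩
  have hdir : Directed (· ⊆ ·) fun n => {x | v n < ‖f x‖ₑ} :=
    Monotone.directed_le fun m n hmn x hx => lt_of_le_of_lt (hv.antitone hmn) hx
  rw [superlevel, hset, hdir.measure_iUnion]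
  refine iSup_le fun n => ?_
  obtain ⟨s, hs, hsv⟩ := sInf_lt_iff.1 (lt_of_le_of_lt h (hvu n).1)
  exact (superlevel_antitone hsv.le).trans hs

lemma lt_decRearr_iff {t : ℝ} {u : ℝ≥0∞} :
    u < decRearr μ f t ↔ ENNReal.ofReal t < superlevel μ f u := by
  rw [← not_le, decRearr_le_iff, not_le]

lemma decRearr_antitone : Antitone (decRearr μ f) := fun _ _ h =>
  decRearr_le_iff.2 <| (decRearr_le_iff.1 le_rfl).trans (ENNReal.ofReal_mono h)

lemma measurable_decRearr : Measurable (decRearr μ f) := decRearr_antitone.measurable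

lemma decRearr_mono (h : ∀ x, ‖f x‖ₑ ≤ ‖g x‖ₑ) (t : ℝ) : decRearr μ f t ≤ decRearr μ g t :=
  decRearr_le_iff.2 <| (superlevel_mono h _).trans (decRearr_le_iff.1 le_rfl)

lemma decRearr_ne_top {C : ℝ≥0∞} (hC : C ≠ ⊤) (h : ∀ x, ‖f x‖ₑ ≤ C) (t : ℝ) :
    decRearr μ f t ≠ ⊤ := by
  refine ne_top_of_le_ne_top hC (decRearr_le_iff.2 ?_)
  have : {x | C < ‖f x‖ₑ} = ∅ := by
    ext x; simpa using h x
  simp [superlevel, this]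

/-- Rearrangement of a finite sum. -/
lemma decRearr_sum_le {ι : Type*} [Fintype ι] [Nonempty ι] {G : ι → α → ℝ}
    (h : ∀ x, ‖f x‖ₑ ≤ ∑ i, ‖G i x‖ₑ) (t : ℝ) :
    decRearr μ f t ≤ ∑ i, decRearr μ (G i) (t * (Fintype.card ι : ℝ)⁻¹) := by
  refine decRearr_le_iff.2 ?_
  set N : ℝ := (Fintype.card ι : ℝ) with hNdef
  have hN : 0 < N := by rw [hNdef]; exact_mod_cast Fintype.card_pos
  -- If the sum exceeds the sum of the heights, some term exceeds its own height; each of these $N$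
  -- events has measure at most $t/N$.
  calc superlevel μ f _ ≤ μ (⋃ i, {x | decRearr μ (G i) (t * N⁻¹) < ‖G i x‖ₑ}) := by
        refine measure_mono fun x hx => ?_
        by_contra hcon
        simp only [mem_iUnion, mem_ofPred_eq, not_exists, not_lt] at hcon
        exact absurd (hx.trans_le (h x)) (not_lt.2 (Finset.sum_le_sum fun i _ => hcon i))
    _ ≤ ∑ i, μ {x | decRearr μ (G i) (t * N⁻¹) < ‖G i x‖ₑ} := by
        exact measure_iUnion_fintype_le _ _
    _ ≤ ∑ _i : ι, ENNReal.ofReal (t * N⁻¹) :=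
        Finset.sum_le_sum fun i _ => decRearr_le_iff.1 le_rfl
    _ = ENNReal.ofReal t := by
        rw [Finset.sum_const, nsmul_eq_mul, Finset.card_univ, ← ENNReal.ofReal_natCast,
          ← ENNReal.ofReal_mul hN.le]
        congr 1; field_simp

/-- Lets the layer cake run over real levels $u>0$ while the values, possibly `⊤`, lie in `ℝ≥0∞`. -/
lemma volume_Ioi_inter_ofReal_lt (c : ℝ≥0∞) :
    volume.restrict (Ioi 0) {u : ℝ | ENNReal.ofReal u < c} = c := by
  rw [Measure.restrict_apply (measurableSet_lt ENNReal.measurable_ofReal measurable_const)]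
  rcases eq_or_ne c ⊤ with rfl | hc
  · have : {u : ℝ | ENNReal.ofReal u < ⊤} ∩ Ioi 0 = Ioi 0 := by ext; simp
    rw [this, Real.volume_Ioi]
  · have : {u : ℝ | ENNReal.ofReal u < c} ∩ Ioi 0 = Ioo 0 c.toReal := by
      ext u
      simp only [mem_inter_iff, mem_ofPred_eq, mem_Ioi, mem_Ioo]
      rw [and_comm]
      exact and_congr_right fun hu => ENNReal.ofReal_lt_iff_lt_toReal hu.le hc
    rw [this, Real.volume_Ioo, sub_zero, ENNReal.ofReal_toReal hc]

lemma volume_Ioc_inter_ofReal_lt (t : ℝ) (c : ℝ≥0∞) :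
    volume.restrict (Ioc 0 t) {u : ℝ | ENNReal.ofReal u < c} = min (ENNReal.ofReal t) c := by
  rw [Measure.restrict_congr_set Ioo_ae_eq_Ioc.symm]
  have h := volume_Ioi_inter_ofReal_lt (min (ENNReal.ofReal t) c)
  have hm : ∀ d : ℝ≥0∞, MeasurableSet {u : ℝ | ENNReal.ofReal u < d} := fun d =>
    measurableSet_lt ENNReal.measurable_ofReal measurable_const
  rw [Measure.restrict_apply (hm _)] at h ⊢
  rw [← h]
  congr 1
  ext u
  simp only [mem_inter_iff, mem_ofPred_eq, mem_Ioo, mem_Ioi, lt_min_iff]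
  constructor
  · rintro ⟨h1, h2, h3⟩
    exact ⟨⟨(ENNReal.ofReal_lt_ofReal_iff (h2.trans h3)).2 h3, h1⟩, h2⟩
  · rintro ⟨⟨h1, h2⟩, h3⟩
    exact ⟨h2, h3, (ENNReal.ofReal_lt_ofReal_iff_of_nonneg (le_of_lt h3)).1 h1⟩

/-- Weighted layer cake formula. -/
lemma lintegral_mul_layerCake [SFinite μ] {h w : α → ℝ≥0∞} (hh : Measurable h)
    (hw : Measurable w) :
    ∫⁻ x, h x * w x ∂μ = ∫⁻ u in Ioi (0 : ℝ), ∫⁻ x in {x | ENNReal.ofReal u < h x}, w x ∂μ := by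
  have hset : MeasurableSet {z : α × ℝ | ENNReal.ofReal z.2 < h z.1} :=
    measurableSet_lt (ENNReal.measurable_ofReal.comp measurable_snd) (hh.comp measurable_fst)
  have h1 : ∀ x, h x * w x = ∫⁻ u in Ioi (0 : ℝ),
      {z : α × ℝ | ENNReal.ofReal z.2 < h z.1}.indicator (fun z => w z.1) (x, u) := by
    intro x
    have : ∀ u : ℝ, {z : α × ℝ | ENNReal.ofReal z.2 < h z.1}.indicator (fun z => w z.1) (x, u)
        = {u : ℝ | ENNReal.ofReal u < h x}.indicator (fun _ => w x) u := fun u => rfl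
    simp_rw [this]
    rw [lintegral_indicator_const
      (measurableSet_lt ENNReal.measurable_ofReal measurable_const),
      volume_Ioi_inter_ofReal_lt, mul_comm]
  simp_rw [h1]
  rw [lintegral_lintegral_swap]
  · refine lintegral_congr fun u => ?_
    rw [← lintegral_indicator (measurableSet_lt measurable_const hh)]
    rfl
  · exact ((hw.comp measurable_fst).indicator hset).aemeasurable

lemma lintegral_layerCake [SFinite μ] {h : α → ℝ≥0∞} (hh : Measurable h) :
    ∫⁻ x, h x ∂μ = ∫⁻ u in Ioi (0 : ℝ), μ {x | ENNReal.ofReal u < h x} := by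
  simpa using lintegral_mul_layerCake (μ := μ) hh measurable_one

/-- Layer cake: the part of $(0,t]$ where $f^*>u$ has length $\min(t,|\{|f|>u\}|)$. All facts on
$f^{**}$ are reduced to the distribution function this way. -/
lemma setLIntegral_decRearr (t : ℝ) :
    ∫⁻ s in Ioc 0 t, decRearr μ f s
      = ∫⁻ u in Ioi (0 : ℝ), min (ENNReal.ofReal t) (superlevel μ f (ENNReal.ofReal u)) := by
  rw [lintegral_layerCake measurable_decRearr]
  refine lintegral_congr fun u => ?_
  simp_rw [lt_decRearr_iff]
  exact volume_Ioc_inter_ofReal_lt _ _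

lemma lintegral_enorm_eq_decRearr [SFinite μ] (hf : Measurable f) :
    ∫⁻ x, ‖f x‖ₑ ∂μ = ∫⁻ s in Ioi (0 : ℝ), decRearr μ f s := by
  rw [lintegral_layerCake measurable_decRearr, lintegral_layerCake hf.enorm]
  refine lintegral_congr fun u => ?_
  simp_rw [lt_decRearr_iff]
  exact (volume_Ioi_inter_ofReal_lt _).symm

/-- The Hardy–Littlewood inequality for a set of measure at most `t`. -/
lemma setLIntegral_le_decRearrAvg [SFinite μ] (hf : Measurable f) {A : Set α}
    {t : ℝ} (ht : 0 < t) (hA : μ A ≤ ENNReal.ofReal t) :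
    ∫⁻ x in A, ‖f x‖ₑ ∂μ ≤ ENNReal.ofReal t * decRearrAvg μ f t := by
  rw [decRearrAvg, ENNReal.mul_div_cancel (by simpa using ht) ENNReal.ofReal_ne_top,
    setLIntegral_decRearr, lintegral_layerCake hf.enorm]
  refine lintegral_mono fun u => le_min ?_ ?_
  · exact ((measure_mono (subset_univ _)).trans_eq (by simp)).trans hA
  · exact Measure.restrict_apply_le _ _

lemma measurable_decRearrAvg : Measurable (decRearrAvg μ f) := by
  refine Measurable.div (Monotone.measurable fun s t h => ?_) ENNReal.measurable_ofReal
  exact lintegral_mono_set (Ioc_subset_Ioc_right h)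

lemma decRearr_le_avg {t : ℝ} (ht : 0 < t) : decRearr μ f t ≤ decRearrAvg μ f t := by
  rw [decRearrAvg, ENNReal.le_div_iff_mul_le (by simp [ht]) (by simp)]
  calc decRearr μ f t * ENNReal.ofReal t = ∫⁻ _ in Ioc 0 t, decRearr μ f t := by simp
    _ ≤ _ := setLIntegral_mono measurable_decRearr fun s hs => decRearr_antitone hs.2

/-- The oscillation `f^{**} - f^*` in terms of the distribution function. -/
lemma decRearrAvg_sub {t : ℝ} (ht : 0 < t) (hfin : decRearr μ f t ≠ ⊤) :
    decRearrAvg μ f t - decRearr μ f t = (∫⁻ u in Ioi (0 : ℝ),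
      {u : ℝ | superlevel μ f (ENNReal.ofReal u) ≤ ENNReal.ofReal t}.indicator
        (fun u => superlevel μ f (ENNReal.ofReal u)) u) / ENNReal.ofReal t := by
  have hms : MeasurableSet {u : ℝ | superlevel μ f (ENNReal.ofReal u) ≤ ENNReal.ofReal t} :=
    measurableSet_le measurable_superlevel_ofReal measurable_const
  have hlt : {u : ℝ | superlevel μ f (ENNReal.ofReal u) ≤ ENNReal.ofReal t}ᶜ
      = {u : ℝ | ENNReal.ofReal u < decRearr μ f t} := by
    ext u; simp [lt_decRearr_iff]
  -- Split the levels: those with distribution above $t$ are exactly $u<f^*(t)$ and contribute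
  -- $t\,f^*(t)$; the others form the oscillation.
  have key : decRearrAvg μ f t = (∫⁻ u in Ioi (0 : ℝ),
      {u : ℝ | superlevel μ f (ENNReal.ofReal u) ≤ ENNReal.ofReal t}.indicator
        (fun u => superlevel μ f (ENNReal.ofReal u)) u) / ENNReal.ofReal t
        + decRearr μ f t := by
    have h0 : decRearr μ f t
        = (∫⁻ u in Ioi (0 : ℝ), {u : ℝ | superlevel μ f (ENNReal.ofReal u)
            ≤ ENNReal.ofReal t}ᶜ.indicator (fun _ => ENNReal.ofReal t) u) / ENNReal.ofReal t := by
      rw [lintegral_indicator_const hms.compl, hlt, volume_Ioi_inter_ofReal_lt, mul_comm,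
        ENNReal.mul_div_cancel_right (by simpa using ht) ENNReal.ofReal_ne_top]
    rw [decRearrAvg, setLIntegral_decRearr]
    conv_rhs => rw [h0]
    rw [← ENNReal.add_div, ← lintegral_add_left (measurable_superlevel_ofReal.indicator hms)]
    congr 1
    refine lintegral_congr fun u => ?_
    by_cases hu : superlevel μ f (ENNReal.ofReal u) ≤ ENNReal.ofReal t
    · simp [indicator, hu]
    · simp [indicator, hu, (not_le.1 hu).le]
  rw [key, ENNReal.add_sub_cancel_right hfin]

end Rearrangement

/-! ### The functional `haarNorm` -/

section HaarNorm

variable {q : ℝ≥0∞} {φ ψ : ℝ → ℝ≥0∞}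

lemma haarNorm_top : haarNorm ⊤ φ = ⨆ t ∈ Ioi (0 : ℝ), φ t := if_pos rfl

lemma haarNorm_of_ne_top (hq : q ≠ ⊤) : haarNorm q φ
    = (∫⁻ t in Ioi (0 : ℝ), φ t ^ q.toReal * ENNReal.ofReal t⁻¹) ^ (1 / q.toReal) := if_neg hq

lemma haarNorm_one : haarNorm 1 φ = ∫⁻ t in Ioi (0 : ℝ), φ t * ENNReal.ofReal t⁻¹ := by
  simp [haarNorm_of_ne_top]

lemma haarNorm_mono (h : ∀ t, 0 < t → φ t ≤ ψ t) : haarNorm q φ ≤ haarNorm q ψ := by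
  rcases eq_or_ne q ⊤ with rfl | hq
  · rw [haarNorm_top, haarNorm_top]
    exact iSup₂_mono fun t ht => h t ht
  · rw [haarNorm_of_ne_top hq, haarNorm_of_ne_top hq]
    refine ENNReal.rpow_le_rpow (setLIntegral_mono' measurableSet_Ioi fun t ht => ?_) (by positivity)
    gcongr
    exact h t ht

lemma haarNorm_const_mul (hq : 1 ≤ q) {c : ℝ≥0∞} (hc : c ≠ ⊤) :
    haarNorm q (fun t => c * φ t) = c * haarNorm q φ := by
  rcases eq_or_ne q ⊤ with rfl | hq'
  · simp_rw [haarNorm_top, ENNReal.mul_iSup]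
  · have hr : 1 ≤ q.toReal := by simpa using ENNReal.toReal_mono hq' hq
    have hr0 : 0 < q.toReal := by linarith
    rw [haarNorm_of_ne_top hq', haarNorm_of_ne_top hq']
    simp_rw [ENNReal.mul_rpow_of_nonneg _ _ hr0.le, mul_assoc]
    rw [lintegral_const_mul' _ _ (ENNReal.rpow_ne_top_of_nonneg hr0.le hc),
      ENNReal.mul_rpow_of_nonneg _ _ (by positivity), ← ENNReal.rpow_mul]
    simp [hr0.ne']

lemma haarNorm_add_le (hq : 1 ≤ q) (hφ : Measurable φ) (hψ : Measurable ψ) :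
    haarNorm q (fun t => φ t + ψ t) ≤ haarNorm q φ + haarNorm q ψ := by
  rcases eq_or_ne q ⊤ with rfl | hq'
  · simp_rw [haarNorm_top]
    refine iSup₂_le fun t ht => ?_
    exact add_le_add (le_iSup₂_of_le t ht le_rfl) (le_iSup₂_of_le t ht le_rfl)
  · have hr : 1 ≤ q.toReal := by simpa using ENNReal.toReal_mono hq' hq
    have hm : Measurable fun t : ℝ => ENNReal.ofReal t⁻¹ :=
      ENNReal.measurable_ofReal.comp measurable_inv
    have hd : ∀ χ : ℝ → ℝ≥0∞, Measurable χ →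
        ∫⁻ t in Ioi (0 : ℝ), χ t ^ q.toReal * ENNReal.ofReal t⁻¹
          = ∫⁻ t, χ t ^ q.toReal
            ∂((volume.restrict (Ioi 0)).withDensity fun t => ENNReal.ofReal t⁻¹) := by
      intro χ hχ
      rw [lintegral_withDensity_eq_lintegral_mul _ hm (hχ.pow_const _)]
      exact lintegral_congr fun t => mul_comm _ _
    rw [haarNorm_of_ne_top hq', haarNorm_of_ne_top hq', haarNorm_of_ne_top hq', hd _ hφ, hd _ hψ,
      hd (fun t => φ t + ψ t) (hφ.add hψ)]
    exact ENNReal.lintegral_Lp_add_le hφ.aemeasurable hψ.aemeasurable hr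

lemma haarNorm_sum_le {ι : Type*} (s : Finset ι) (hq : 1 ≤ q) {Φ : ι → ℝ → ℝ≥0∞}
    (hΦ : ∀ i, Measurable (Φ i)) :
    haarNorm q (fun t => ∑ i ∈ s, Φ i t) ≤ ∑ i ∈ s, haarNorm q (Φ i) := by
  classical
  induction s using Finset.induction_on with
  | empty =>
    have := haarNorm_const_mul (φ := fun _ => 0) hq (c := 0) (by simp)
    simp only [zero_mul] at this
    simp [this]
  | insert i s hi ih =>
    simp_rw [Finset.sum_insert hi]
    refine (haarNorm_add_le hq (hΦ i) (Finset.measurable_sum _ fun i _ => hΦ i)).trans ?_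
    gcongr

lemma lintegral_Ioi_comp_mul_right {h : ℝ → ℝ≥0∞} (hh : Measurable h) {a : ℝ} (ha : 0 < a) :
    ∫⁻ t in Ioi (0 : ℝ), h (t * a) = ENNReal.ofReal a⁻¹ * ∫⁻ t in Ioi (0 : ℝ), h t := by
  have h1 : ∀ t, (Ioi (0 : ℝ)).indicator (fun t => h (t * a)) t
      = (Ioi (0 : ℝ)).indicator h (t * a) := by
    intro t
    by_cases ht : 0 < t
    · simp [indicator, ht, mul_pos ht ha]
    · have : ¬ 0 < t * a := by
        rw [mul_pos_iff_of_pos_right ha]; exact ht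
      simp [indicator, ht, this]
  rw [← lintegral_indicator measurableSet_Ioi, ← lintegral_indicator measurableSet_Ioi]
  simp_rw [h1]
  rw [← lintegral_map (hh.indicator measurableSet_Ioi) (measurable_mul_const a),
    Real.map_volume_mul_right ha.ne', lintegral_smul_measure, abs_of_pos (inv_pos.2 ha),
    smul_eq_mul]

lemma lintegral_haar_comp_mul_right {h : ℝ → ℝ≥0∞} (hh : Measurable h) {a : ℝ} (ha : 0 < a) :
    ∫⁻ t in Ioi (0 : ℝ), h (t * a) * ENNReal.ofReal t⁻¹
      = ∫⁻ t in Ioi (0 : ℝ), h t * ENNReal.ofReal t⁻¹ := by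
  have hm : Measurable fun t : ℝ => ENNReal.ofReal t⁻¹ :=
    ENNReal.measurable_ofReal.comp measurable_inv
  have h2 := lintegral_Ioi_comp_mul_right (hh.mul hm) ha
  have h3 : ∫⁻ t in Ioi (0 : ℝ), h (t * a) * ENNReal.ofReal t⁻¹
      = ENNReal.ofReal a * ∫⁻ t in Ioi (0 : ℝ), (h * fun t => ENNReal.ofReal t⁻¹) (t * a) := by
    rw [← lintegral_const_mul' _ _ ENNReal.ofReal_ne_top]
    refine lintegral_congr fun t => ?_
    simp only [Pi.mul_apply]
    rw [mul_left_comm, ← ENNReal.ofReal_mul ha.le]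
    congr 3
    field_simp
  rw [h3, h2, ← mul_assoc, ← ENNReal.ofReal_mul ha.le, mul_inv_cancel₀ ha.ne', ENNReal.ofReal_one,
    one_mul]
  rfl

/-- Hölder against the constant 1. With Tonelli it takes the place of Minkowski's integral
inequality below. -/
lemma lintegral_rpow_le_of_one_le {Ω : Type*} [MeasurableSpace Ω] (ν : Measure Ω)
    {h : Ω → ℝ≥0∞} (hh : Measurable h) {r : ℝ} (hr : 1 ≤ r) :
    (∫⁻ x, h x ∂ν) ^ r ≤ (∫⁻ x, h x ^ r ∂ν) * ν univ ^ (r - 1) := by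
  rcases hr.eq_or_lt with rfl | hr
  · simp
  have hr0 : 0 < r := by linarith
  have hc := Real.HolderConjugate.conjExponent hr
  have h1 := ENNReal.lintegral_mul_le_Lp_mul_Lq ν hc hh.aemeasurable
    (aemeasurable_const (b := (1 : ℝ≥0∞)))
  simp only [Pi.mul_apply, mul_one, ENNReal.one_rpow, lintegral_const, one_mul] at h1
  calc (∫⁻ x, h x ∂ν) ^ r ≤ _ := ENNReal.rpow_le_rpow h1 hr0.le
    _ = _ := by
      rw [ENNReal.mul_rpow_of_nonneg _ _ hr0.le, ← ENNReal.rpow_mul, ← ENNReal.rpow_mul]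
      congr 2
      · rw [one_div, inv_mul_cancel₀ hr0.ne', ENNReal.rpow_one]
      · rw [Real.conjExponent]; field_simp

/-- Averaging over dilations is bounded on the spaces `L^q(dt/t)`. -/
lemma haarNorm_lintegral_dilation_le (hq : 1 ≤ q) (hφ : Measurable φ) (ν : Measure ℝ) [SFinite ν]
    (hν : ∀ᵐ σ ∂ν, 0 < σ) :
    haarNorm q (fun t => ∫⁻ σ, φ (t * σ) ∂ν) ≤ ν univ * haarNorm q φ := by
  rcases eq_or_ne q ⊤ with rfl | hq'
  · simp_rw [haarNorm_top]
    refine iSup₂_le fun t ht => ?_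
    calc ∫⁻ σ, φ (t * σ) ∂ν ≤ ∫⁻ _, (⨆ t ∈ Ioi (0 : ℝ), φ t) ∂ν :=
          lintegral_mono_ae <| hν.mono fun σ hσ =>
            le_iSup₂_of_le (f := fun t (_ : t ∈ Ioi (0 : ℝ)) => φ t) (t * σ) (mul_pos ht hσ) le_rfl
      _ = _ := by rw [lintegral_const, mul_comm]
  have hr : 1 ≤ q.toReal := by simpa using ENNReal.toReal_mono hq' hq
  rw [haarNorm_of_ne_top hq', haarNorm_of_ne_top hq']
  set r := q.toReal
  have hr0 : 0 < r := by linarith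
  have hm : Measurable fun t : ℝ => ENNReal.ofReal t⁻¹ :=
    ENNReal.measurable_ofReal.comp measurable_inv
  have hφ2 : Measurable fun z : ℝ × ℝ => φ (z.1 * z.2) := hφ.comp measurable_mul
  have hφ3 : Measurable fun z : ℝ × ℝ => φ (z.1 * z.2) ^ r * ENNReal.ofReal z.1⁻¹ :=
    (hφ2.pow_const r).mul (hm.comp measurable_fst)
  -- Hölder in `σ`, then Tonelli, then invariance of $dt/t$ under $t\mapsto t\sigma$.
  have hmain : ∫⁻ t in Ioi (0 : ℝ), (∫⁻ σ, φ (t * σ) ∂ν) ^ r * ENNReal.ofReal t⁻¹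
      ≤ ν univ ^ r * ∫⁻ t in Ioi (0 : ℝ), φ t ^ r * ENNReal.ofReal t⁻¹ := by
    calc ∫⁻ t in Ioi (0 : ℝ), (∫⁻ σ, φ (t * σ) ∂ν) ^ r * ENNReal.ofReal t⁻¹
        ≤ ∫⁻ t in Ioi (0 : ℝ), (∫⁻ σ, φ (t * σ) ^ r * ENNReal.ofReal t⁻¹ ∂ν)
            * ν univ ^ (r - 1) := by
          refine lintegral_mono fun t => ?_
          rw [lintegral_mul_const' _ _ ENNReal.ofReal_ne_top, mul_right_comm]
          gcongr
          exact lintegral_rpow_le_of_one_le ν (hφ.comp (measurable_const_mul t)) hr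
      _ = (∫⁻ σ, (∫⁻ t in Ioi (0 : ℝ), φ (t * σ) ^ r * ENNReal.ofReal t⁻¹) ∂ν)
            * ν univ ^ (r - 1) := by
          rw [lintegral_mul_const _ hφ3.lintegral_prod_right',
            lintegral_lintegral_swap hφ3.aemeasurable]
      _ = (∫⁻ _, (∫⁻ t in Ioi (0 : ℝ), φ t ^ r * ENNReal.ofReal t⁻¹) ∂ν) * ν univ ^ (r - 1) := by
          congr 1
          exact lintegral_congr_ae <| hν.mono fun σ hσ =>
            lintegral_haar_comp_mul_right (hφ.pow_const r) hσ
      _ = _ := by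
          rw [lintegral_const, mul_assoc, mul_comm]
          congr 1
          nth_rw 1 [← ENNReal.rpow_one (ν univ)]
          rw [← ENNReal.rpow_add_of_nonneg _ _ zero_le_one (by linarith)]
          congr 1; ring
  refine (ENNReal.rpow_le_rpow hmain (by positivity)).trans_eq ?_
  rw [ENNReal.mul_rpow_of_nonneg _ _ (by positivity), ← ENNReal.rpow_mul]
  simp [hr0.ne']

end HaarNorm

/-! ### Hardy's inequalities -/

lemma lintegral_Ioo_rpow {c : ℝ} (hc : 0 ≤ c) {a : ℝ} (ha : -1 < a) :
    ∫⁻ s in Ioo 0 c, ENNReal.ofReal (s ^ a) = ENNReal.ofReal (c ^ (a + 1) / (a + 1)) := by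
  rw [restrict_Ioo_eq_restrict_Ioc]
  rw [← ofReal_integral_eq_lintegral_ofReal, ← intervalIntegral.integral_of_le hc,
    integral_rpow (Or.inl ha), Real.zero_rpow (by linarith), sub_zero]
  · exact (intervalIntegrable_iff_integrableOn_Ioc_of_le hc).1
      (intervalIntegral.intervalIntegrable_rpow' ha)
  · exact (ae_restrict_mem measurableSet_Ioc).mono fun s hs => Real.rpow_nonneg hs.1.le _

lemma lintegral_Ioi_rpow {c : ℝ} (hc : 0 < c) {a : ℝ} (ha : a < -1) :
    ∫⁻ s in Ioi c, ENNReal.ofReal (s ^ a) = ENNReal.ofReal (-c ^ (a + 1) / (a + 1)) := by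
  rw [← ofReal_integral_eq_lintegral_ofReal (integrableOn_Ioi_rpow_of_lt ha hc),
    integral_Ioi_rpow_of_lt ha hc]
  exact (ae_restrict_mem measurableSet_Ioi).mono fun s hs =>
    Real.rpow_nonneg (hc.trans hs).le _

lemma measurable_ofReal_rpow (a : ℝ) : Measurable fun s : ℝ => ENNReal.ofReal (s ^ a) :=
  ENNReal.measurable_ofReal.comp (measurable_id.pow_const a)

/-- Hardy's inequality for the average `(1/t) ∫_0^t h`. -/
lemma haarNorm_hardy_avg {q : ℝ≥0∞} (hq : 1 ≤ q) {h : ℝ → ℝ≥0∞} (hh : Measurable h) {a : ℝ}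
    (ha : a < 1) :
    haarNorm q (fun t => (∫⁻ s in Ioc 0 t, h s) / ENNReal.ofReal t * ENNReal.ofReal (t ^ a))
      ≤ ENNReal.ofReal (1 / (1 - a)) * haarNorm q (fun t => h t * ENNReal.ofReal (t ^ a)) := by
  -- Substituting $s=t\sigma$ turns the weighted average into a dilation average of $h(t)t^a$ with
  -- density $\sigma^{-a}$ on $(0,1)$, of mass $1/(1-a)$.
  set ν : Measure ℝ := (volume.restrict (Ioo 0 1)).withDensity fun σ => ENNReal.ofReal (σ ^ (-a))
  have hac : ν ≪ volume.restrict (Ioo 0 1) := withDensity_absolutelyContinuous _ _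
  have hν : ∀ᵐ σ ∂ν, 0 < σ :=
    hac.ae_le ((ae_restrict_mem measurableSet_Ioo).mono fun σ hσ => hσ.1)
  have hνu : ν univ = ENNReal.ofReal (1 / (1 - a)) := by
    rw [withDensity_apply _ MeasurableSet.univ, Measure.restrict_univ,
      lintegral_Ioo_rpow zero_le_one (by linarith)]
    simp; ring_nf
  have hφ : Measurable fun t => h t * ENNReal.ofReal (t ^ a) :=
    hh.mul (measurable_ofReal_rpow a)
  rw [← hνu]
  refine le_trans (haarNorm_mono fun t ht => le_of_eq ?_)
    (haarNorm_lintegral_dilation_le hq hφ ν hν)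
  rw [show ∫⁻ σ, h (t * σ) * ENNReal.ofReal ((t * σ) ^ a) ∂ν = _ from
    lintegral_withDensity_eq_lintegral_mul _ (measurable_ofReal_rpow _)
      (hφ.comp (measurable_const_mul t))]
  have h1 : ∫⁻ s in Ioc 0 t, h s
      = ENNReal.ofReal t * ∫⁻ σ in Ioo (0 : ℝ) 1, h (t * σ) := by
    have h2 := lintegral_Ioi_comp_mul_right (hh.indicator (measurableSet_Iio (a := t))) ht
    have h3 : ∫⁻ s in Ioi (0 : ℝ), (Iio t).indicator h s = ∫⁻ s in Ioc 0 t, h s := by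
      rw [lintegral_indicator measurableSet_Iio, Measure.restrict_restrict measurableSet_Iio,
        ← restrict_Ioo_eq_restrict_Ioc, Iio_inter_Ioi]
    have h4 : ∫⁻ s in Ioi (0 : ℝ), (Iio t).indicator h (s * t)
        = ∫⁻ σ in Ioo (0 : ℝ) 1, h (t * σ) := by
      rw [← Iio_inter_Ioi, ← Measure.restrict_restrict measurableSet_Iio,
        ← lintegral_indicator measurableSet_Iio]
      refine lintegral_congr fun s => ?_
      simp only [indicator, mem_Iio, mul_comm s t]
      congr 1
      simp [mul_lt_iff_lt_one_right ht]
    rw [← h3, ← h4, h2, ← mul_assoc, ← ENNReal.ofReal_mul ht.le, mul_inv_cancel₀ ht.ne',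
      ENNReal.ofReal_one, one_mul]
  rw [h1, mul_comm (ENNReal.ofReal t), ENNReal.mul_div_cancel_right (by simpa using ht)
    ENNReal.ofReal_ne_top, ← lintegral_mul_const' _ _ ENNReal.ofReal_ne_top]
  refine setLIntegral_congr_fun measurableSet_Ioo fun σ hσ => ?_
  simp only [Pi.mul_apply]
  rw [mul_left_comm, ← ENNReal.ofReal_mul (Real.rpow_nonneg hσ.1.le _),
    Real.mul_rpow ht.le hσ.1.le, mul_left_comm (σ ^ (-a)), ← Real.rpow_add hσ.1]
  simp

/-- Hardy's inequality for the tail integral `∫_t^∞ h(s) ds/s`. -/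
lemma haarNorm_hardy_tail {q : ℝ≥0∞} (hq : 1 ≤ q) {h : ℝ → ℝ≥0∞} (hh : Measurable h) {b : ℝ}
    (hb : 0 < b) :
    haarNorm q (fun t => (∫⁻ s in Ioi t, h s * ENNReal.ofReal s⁻¹) * ENNReal.ofReal (t ^ b))
      ≤ ENNReal.ofReal (1 / b) * haarNorm q (fun t => h t * ENNReal.ofReal (t ^ b)) := by
  -- As for averages, now over $\sigma>1$: $d\sigma/\sigma$ and the weight combine to
  -- $\sigma^{-b-1}$, of mass $1/b$.
  set ν : Measure ℝ :=
    (volume.restrict (Ioi 1)).withDensity fun σ => ENNReal.ofReal (σ ^ (-b - 1))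
  have hac : ν ≪ volume.restrict (Ioi 1) := withDensity_absolutelyContinuous _ _
  have hν : ∀ᵐ σ ∂ν, 0 < σ :=
    hac.ae_le ((ae_restrict_mem measurableSet_Ioi).mono fun σ hσ => zero_lt_one.trans hσ)
  have hνu : ν univ = ENNReal.ofReal (1 / b) := by
    rw [withDensity_apply _ MeasurableSet.univ, Measure.restrict_univ,
      lintegral_Ioi_rpow zero_lt_one (by linarith)]
    simp [neg_div_neg_eq]
  have hφ : Measurable fun t => h t * ENNReal.ofReal (t ^ b) :=
    hh.mul (measurable_ofReal_rpow b)
  have hm : Measurable fun t : ℝ => ENNReal.ofReal t⁻¹ :=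
    ENNReal.measurable_ofReal.comp measurable_inv
  rw [← hνu]
  refine le_trans (haarNorm_mono fun t ht => le_of_eq ?_)
    (haarNorm_lintegral_dilation_le hq hφ ν hν)
  rw [show ∫⁻ σ, h (t * σ) * ENNReal.ofReal ((t * σ) ^ b) ∂ν = _ from
    lintegral_withDensity_eq_lintegral_mul _ (measurable_ofReal_rpow _)
      (hφ.comp (measurable_const_mul t))]
  have h1 : ∫⁻ s in Ioi t, h s * ENNReal.ofReal s⁻¹
      = ∫⁻ σ in Ioi (1 : ℝ), h (t * σ) * ENNReal.ofReal σ⁻¹ := by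
    have h2 := lintegral_haar_comp_mul_right (hh.indicator (measurableSet_Ioi (a := t))) ht
    have hind : ∀ (c : ℝ) (H : ℝ → ℝ≥0∞), 0 < c → ∫⁻ s in Ioi (0 : ℝ), (Ioi c).indicator H s
        = ∫⁻ s in Ioi c, H s := by
      intro c H hc
      rw [lintegral_indicator measurableSet_Ioi, Measure.restrict_restrict measurableSet_Ioi,
        inter_eq_left.2 (Ioi_subset_Ioi hc.le)]
    rw [← hind t _ ht, ← hind 1 _ one_pos]
    simp_rw [indicator_mul_left]
    rw [← h2]
    refine lintegral_congr fun s => ?_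
    simp only [indicator, mem_Ioi, mul_comm s t]
    congr 2
    simp [lt_mul_iff_one_lt_right ht]
  rw [h1, ← lintegral_mul_const' _ _ ENNReal.ofReal_ne_top]
  refine setLIntegral_congr_fun measurableSet_Ioi fun σ hσ => ?_
  have hσ0 : 0 < σ := zero_lt_one.trans hσ
  simp only [Pi.mul_apply]
  rw [mul_left_comm, mul_assoc, ← ENNReal.ofReal_mul (Real.rpow_nonneg hσ0.le _),
    ← ENNReal.ofReal_mul (inv_nonneg.2 hσ0.le),
    Real.mul_rpow ht.le hσ0.le, mul_left_comm (σ ^ (-b - 1)), ← Real.rpow_add hσ0]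
  congr 2
  rw [show -b - 1 + b = (-1 : ℝ) by ring, Real.rpow_neg_one, mul_comm]

/-! ### Integrated forms of the oscillation -/

section Oscillation

variable {α : Type*} [MeasurableSpace α] {μ : Measure α} {f : α → ℝ}

/-- The inner integral in the Fubini argument of `lintegral_oscillation`: $\int_{\max(t,m)}^\infty
s^{-2}\,ds$. -/
lemma lintegral_rpow_neg_two_inter (t : ℝ) {m : ℝ≥0∞} (hm : m ≠ ⊤) :
    m * ∫⁻ s in Ioi t, {s : ℝ | m ≤ ENNReal.ofReal s}.indicator
      (fun s => ENNReal.ofReal (s ^ (-2 : ℝ))) s = m / max (ENNReal.ofReal t) m := by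
  rcases eq_or_ne m 0 with rfl | hm0
  · simp
  lift m to ℝ≥0 using hm
  have hm0' : 0 < (m : ℝ) := by
    have : m ≠ 0 := by simpa using hm0
    positivity
  set c : ℝ := max t m
  have hc : 0 < c := lt_max_of_lt_right hm0'
  have hset : {s : ℝ | (m : ℝ≥0∞) ≤ ENNReal.ofReal s} = Ici (m : ℝ) := by
    ext s
    simp only [mem_ofPred_eq, mem_Ici]
    rw [← ENNReal.ofReal_coe_nnreal, ENNReal.ofReal_le_ofReal_iff']
    simp [hm0'.not_ge]
  have hae : (Ici (m : ℝ) ∩ Ioi t : Set ℝ) =ᵐ[volume] Ioi c := by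
    have : Ioi c = Ioi (m : ℝ) ∩ Ioi t := by
      rw [Ioi_inter_Ioi, max_comm]
    rw [this]
    exact Ioi_ae_eq_Ici.symm.inter (ae_eq_refl _)
  have hcm : max (ENNReal.ofReal t) m = ENNReal.ofReal c := by
    rw [← ENNReal.ofReal_coe_nnreal, ENNReal.ofReal_max]
  rw [hset, lintegral_indicator measurableSet_Ici, Measure.restrict_restrict measurableSet_Ici,
    Measure.restrict_congr_set hae, lintegral_Ioi_rpow hc (by norm_num), hcm,
    div_eq_mul_inv (m : ℝ≥0∞), ← ENNReal.ofReal_inv_of_pos hc]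
  congr 2
  rw [show (-2 : ℝ) + 1 = -1 by norm_num, Real.rpow_neg_one]
  simp

/-- The tail integral of the oscillation in terms of the distribution function. -/
lemma lintegral_oscillation (hm : ∀ u : ℝ, 0 < u → superlevel μ f (ENNReal.ofReal u) ≠ ⊤)
    (hfin : ∀ t, decRearr μ f t ≠ ⊤) {t : ℝ} (ht : 0 ≤ t) :
    ∫⁻ s in Ioi t, (decRearrAvg μ f s - decRearr μ f s) * ENNReal.ofReal s⁻¹
      = ∫⁻ u in Ioi (0 : ℝ), superlevel μ f (ENNReal.ofReal u)
        / max (ENNReal.ofReal t) (superlevel μ f (ENNReal.ofReal u)) := by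
  have hset : MeasurableSet {z : ℝ × ℝ | superlevel μ f (ENNReal.ofReal z.2)
      ≤ ENNReal.ofReal z.1} :=
    measurableSet_le (measurable_superlevel_ofReal.comp measurable_snd)
      (ENNReal.measurable_ofReal.comp measurable_fst)
  set Φ : ℝ × ℝ → ℝ≥0∞ := {z : ℝ × ℝ | superlevel μ f (ENNReal.ofReal z.2)
      ≤ ENNReal.ofReal z.1}.indicator fun z =>
        superlevel μ f (ENNReal.ofReal z.2) * ENNReal.ofReal (z.1 ^ (-2 : ℝ)) with hΦ
  have hΦm : Measurable Φ := Measurable.indicator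
    ((measurable_superlevel_ofReal.comp measurable_snd).mul
      ((measurable_ofReal_rpow (-2)).comp measurable_fst)) hset
  calc ∫⁻ s in Ioi t, (decRearrAvg μ f s - decRearr μ f s) * ENNReal.ofReal s⁻¹
      = ∫⁻ s in Ioi t, ∫⁻ u in Ioi (0 : ℝ), Φ (s, u) := by
        refine setLIntegral_congr_fun measurableSet_Ioi fun s hs => ?_
        have hs0 : 0 < s := lt_of_le_of_lt ht hs
        rw [decRearrAvg_sub hs0 (hfin s), div_eq_mul_inv, ← ENNReal.ofReal_inv_of_pos hs0, mul_assoc,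
          ← ENNReal.ofReal_mul (by positivity), ← lintegral_mul_const' _ _ ENNReal.ofReal_ne_top]
        refine lintegral_congr fun u => ?_
        have : s⁻¹ * s⁻¹ = s ^ (-2 : ℝ) := by
          rw [Real.rpow_neg hs0.le, ← mul_inv, ← sq]
          norm_num
        rw [this]
        by_cases hu : superlevel μ f (ENNReal.ofReal u) ≤ ENNReal.ofReal s <;>
          simp [hΦ, indicator, hu]
    _ = ∫⁻ u in Ioi (0 : ℝ), ∫⁻ s in Ioi t, Φ (s, u) := lintegral_lintegral_swap hΦm.aemeasurable
    _ = _ := by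
        refine setLIntegral_congr_fun measurableSet_Ioi fun u hu => ?_
        rw [← lintegral_rpow_neg_two_inter t (hm u hu), ← lintegral_const_mul' _ _ (hm u hu)]
        refine lintegral_congr fun s => ?_
        by_cases hu : superlevel μ f (ENNReal.ofReal u) ≤ ENNReal.ofReal s <;>
          simp [hΦ, indicator, hu]

/-- The integrated form of $(f^{**})'=-(f^{**}-f^*)/t$. No differentiation is needed, because
$m/\max(t,m)=\min(t,m)/t$. -/
lemma decRearrAvg_eq_lintegral_oscillation
    (hm : ∀ u : ℝ, 0 < u → superlevel μ f (ENNReal.ofReal u) ≠ ⊤)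
    (hfin : ∀ t, decRearr μ f t ≠ ⊤) {t : ℝ} (ht : 0 < t) :
    decRearrAvg μ f t
      = ∫⁻ s in Ioi t, (decRearrAvg μ f s - decRearr μ f s) * ENNReal.ofReal s⁻¹ := by
  have ht' : ENNReal.ofReal t ≠ 0 := by simpa using ht
  rw [lintegral_oscillation hm hfin ht.le, decRearrAvg, setLIntegral_decRearr, div_eq_mul_inv,
    ← lintegral_mul_const' _ _ (by simpa using ht)]
  refine setLIntegral_congr_fun measurableSet_Ioi fun u hu => ?_
  have := hm u hu
  rcases le_total (ENNReal.ofReal t) (superlevel μ f (ENNReal.ofReal u)) with h | h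
  · rw [min_eq_left h, max_eq_right h, ENNReal.mul_inv_cancel ht' ENNReal.ofReal_ne_top,
      ENNReal.div_self (fun h0 => ht' (by simpa [h0] using h)) this]
  · rw [min_eq_right h, max_eq_left h, div_eq_mul_inv]

/-- The functional `L(∞,1)` is the supremum norm. -/
lemma haarNorm_one_oscillation (hm : ∀ u : ℝ, 0 < u → superlevel μ f (ENNReal.ofReal u) ≠ ⊤)
    (hfin : ∀ t, decRearr μ f t ≠ ⊤) :
    haarNorm 1 (fun t => decRearrAvg μ f t - decRearr μ f t) = eLpNorm f ⊤ μ := by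
  rw [haarNorm_one, lintegral_oscillation hm hfin le_rfl, eLpNorm_exponent_top,
    ← volume_Ioi_inter_ofReal_lt (eLpNormEssSup f μ), ← lintegral_indicator_one
      (measurableSet_lt ENNReal.measurable_ofReal measurable_const)]
  refine setLIntegral_congr_fun measurableSet_Ioi fun u hu => ?_
  have h0 : superlevel μ f (ENNReal.ofReal u) = 0 ↔ eLpNormEssSup f μ ≤ ENNReal.ofReal u := by
    have : superlevel μ f (ENNReal.ofReal u) = 0 ↔ ∀ᵐ x ∂μ, ‖f x‖ₑ ≤ ENNReal.ofReal u := by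
      rw [ae_iff]; simp [superlevel]
    rw [this]
    exact ⟨fun h => essSup_le_of_ae_le _ h, fun h => (enorm_ae_le_eLpNormEssSup f μ).mono
      fun x hx => hx.trans h⟩
  by_cases h : superlevel μ f (ENNReal.ofReal u) = 0
  -- At $t=0$ the integrand is $m/m$, and $0/0=0$ in `ℝ≥0∞`, so it is the indicator of the levels
  -- below the essential supremum.
  · simp [h, indicator, not_lt.2 (h0.1 h)]
  · have h' : ENNReal.ofReal u < eLpNormEssSup f μ := not_le.1 fun h1 => h (h0.2 h1)
    simp [indicator, h', ENNReal.div_self h (hm u hu)]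

/-- Layer cake for the weight $t^{d-1}dt$: the set $\{f^*>u\}$ is an interval $(0,m)$, of weighted
length $m^d/d$. -/
lemma haarNorm_one_decRearr (hm : ∀ u : ℝ, 0 < u → superlevel μ f (ENNReal.ofReal u) ≠ ⊤)
    {d : ℝ} (hd : 0 < d) :
    haarNorm 1 (fun t => decRearr μ f t * ENNReal.ofReal (t ^ d))
      = ENNReal.ofReal (1 / d)
        * ∫⁻ u in Ioi (0 : ℝ), superlevel μ f (ENNReal.ofReal u) ^ d := by
  have hw : Measurable fun t : ℝ => ENNReal.ofReal (t ^ (d - 1)) := measurable_ofReal_rpow _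
  rw [haarNorm_one]
  have h1 : ∫⁻ t in Ioi (0 : ℝ), decRearr μ f t * ENNReal.ofReal (t ^ d) * ENNReal.ofReal t⁻¹
      = ∫⁻ t in Ioi (0 : ℝ), decRearr μ f t * ENNReal.ofReal (t ^ (d - 1)) := by
    refine setLIntegral_congr_fun measurableSet_Ioi fun t ht => ?_
    have ht : 0 < t := ht
    rw [mul_assoc, ← ENNReal.ofReal_mul (by positivity), Real.rpow_sub_one ht.ne']
    rfl
  rw [h1, lintegral_mul_layerCake measurable_decRearr hw,
    ← lintegral_const_mul' _ _ ENNReal.ofReal_ne_top]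
  refine setLIntegral_congr_fun measurableSet_Ioi fun u hu => ?_
  simp_rw [lt_decRearr_iff]
  have hmu := hm u hu
  set m := superlevel μ f (ENNReal.ofReal u)
  have hset : {t : ℝ | ENNReal.ofReal t < m} ∩ Ioi 0 = Ioo 0 m.toReal := by
    ext s
    simp only [mem_inter_iff, mem_ofPred_eq, mem_Ioi, mem_Ioo]
    rw [and_comm]
    exact and_congr_right fun hs => ENNReal.ofReal_lt_iff_lt_toReal hs.le hmu
  rw [Measure.restrict_restrict (measurableSet_lt ENNReal.measurable_ofReal measurable_const),
    hset, lintegral_Ioo_rpow ENNReal.toReal_nonneg (by linarith), sub_add_cancel,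
    div_eq_inv_mul, ENNReal.ofReal_mul (by positivity), one_div,
    ← ENNReal.ofReal_rpow_of_nonneg ENNReal.toReal_nonneg hd.le, ENNReal.ofReal_toReal hmu]

end Oscillation

/-! ### The Gagliardo–Nirenberg inequality for truncations -/

section Truncation

/-- Bounds truncations $\int_0^{f}\theta$ from below. Evenness of `θ` makes the primitive odd, so
both signs of $f$ are treated at once. -/
lemma abs_intervalIntegral_ge {θ : ℝ → ℝ} (hθ : Continuous θ) (h0 : ∀ s, 0 ≤ θ s)
    (heven : ∀ s, θ (-s) = θ s) {a b c s : ℝ} (ha : 0 ≤ a) (hab : a ≤ b)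
    (hc : ∀ u ∈ Icc a b, c ≤ θ u) (hs : b ≤ |s|) :
    c * (b - a) ≤ |∫ u in (0 : ℝ)..s, θ u| := by
  have key : ∀ r : ℝ, b ≤ r → c * (b - a) ≤ ∫ u in (0 : ℝ)..r, θ u := by
    intro r hr
    calc c * (b - a) = ∫ _ in a..b, c := by simp [mul_comm]
      _ ≤ ∫ u in a..b, θ u :=
        intervalIntegral.integral_mono_on hab (by simp) (hθ.intervalIntegrable _ _) hc
      _ ≤ ∫ u in (0 : ℝ)..r, θ u :=
        intervalIntegral.integral_mono_interval ha hab hr (Filter.Eventually.of_forall h0)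
          (hθ.intervalIntegrable _ _)
  rcases le_total 0 s with h | h
  · rw [abs_of_nonneg h] at hs
    exact (key s hs).trans (le_abs_self _)
  · rw [abs_of_nonpos h] at hs
    refine (key _ hs).trans ?_
    have h1 : ∫ u in (0 : ℝ)..-s, θ u = -∫ u in (0 : ℝ)..s, θ u := by
      have := intervalIntegral.integral_comp_neg (a := 0) (b := -s) θ
      simp only [heven, neg_neg, neg_zero] at this
      rw [this, intervalIntegral.integral_symm]
    rw [h1]
    exact neg_le_abs _

variable {E : Type*} [NormedAddCommGroup E] [NormedSpace ℝ E] [MeasurableSpace E] [BorelSpace E]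
  [FiniteDimensional ℝ E] (μ : Measure E) [μ.IsAddHaarMeasure] {f : E → ℝ}

open Module

lemma contDiff_one_primitive {θ : ℝ → ℝ} (hθ : Continuous θ) :
    ContDiff ℝ 1 fun s => ∫ u in (0 : ℝ)..s, θ u := by
  have hd : deriv (fun s => ∫ u in (0 : ℝ)..s, θ u) = θ :=
    funext fun s => hθ.deriv_integral θ 0 s
  rw [contDiff_one_iff_deriv, hd]
  exact ⟨fun s => (intervalIntegral.integral_hasDerivAt_right (hθ.intervalIntegrable _ _)
    (hθ.stronglyMeasurableAtFilter _ _) hθ.continuousAt).differentiableAt, hθ⟩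

/-- Gagliardo–Nirenberg for a primitive of `θ` composed with $f$; by the chain rule only the levels
where `θ` is nonzero are charged. -/
lemma eLpNorm_truncation_le (hf : ContDiff ℝ 1 f) (hs : HasCompactSupport f)
    {p : ℝ≥0} (hp : NNReal.HolderConjugate (finrank ℝ E) p) {θ : ℝ → ℝ} (hθ : Continuous θ) :
    eLpNorm (fun x => ∫ u in (0 : ℝ)..f x, θ u) p μ
      ≤ eLpNormLESNormFDerivOneConst μ p * ∫⁻ x, ‖θ (f x)‖ₑ * ‖fderiv ℝ f x‖ₑ ∂μ := by
  have h1 := contDiff_one_primitive hθ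
  have h := eLpNorm_le_eLpNorm_fderiv_one μ (h1.comp hf)
    (hs.comp_left (g := fun s => ∫ u in (0 : ℝ)..s, θ u) (by simp)) hp
  refine h.trans_eq ?_
  rw [eLpNorm_one_eq_lintegral_enorm]
  congr 1
  refine lintegral_congr fun x => ?_
  have hd : HasDerivAt (fun s => ∫ u in (0 : ℝ)..s, θ u) (θ (f x)) (f x) :=
    intervalIntegral.integral_hasDerivAt_right (hθ.intervalIntegrable _ _)
      (hθ.stronglyMeasurableAtFilter _ _) hθ.continuousAt
  have h2 := hd.comp_hasFDerivAt x (hf.differentiable one_ne_zero x).hasFDerivAt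
  rw [h2.fderiv, enorm_smul]

end Truncation

/-! ### Finiteness for compactly supported functions -/

section CompactSupport

variable {X : Type*} [TopologicalSpace X] [MeasurableSpace X] {f : X → ℝ}

lemma superlevel_ne_top_of_hasCompactSupport (μ : Measure X) [IsFiniteMeasureOnCompacts μ]
    (hs : HasCompactSupport f) (u : ℝ≥0∞) :
    superlevel μ f u ≠ ⊤ := by
  refine ne_top_of_le_ne_top hs.isCompact.measure_lt_top.ne (measure_mono fun x hx => ?_)
  refine subset_tsupport f fun h => ?_
  simp [h] at hx

lemma decRearr_ne_top_of_hasCompactSupport (μ : Measure X) (hf : Continuous f) (hs : HasCompactSupport f) (t : ℝ) :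
    decRearr μ f t ≠ ⊤ := by
  obtain ⟨C, hC⟩ := hs.exists_bound_of_continuous hf
  refine decRearr_ne_top (C := ENNReal.ofReal C) ENNReal.ofReal_ne_top (fun x => ?_) t
  rw [← ofReal_norm]
  exact ENNReal.ofReal_le_ofReal (hC x)

end CompactSupport

/-! ### Estimates for $f^{**}-f^*$ and for level layers by truncation -/

section Sobolev

variable {E : Type*} [NormedAddCommGroup E] [NormedSpace ℝ E] [MeasurableSpace E] [BorelSpace E]
  [FiniteDimensional ℝ E] {μ : Measure E} [μ.IsAddHaarMeasure] {f : E → ℝ}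

open Module

lemma lintegral_Ioi_superlevel (hf : Continuous f) {c : ℝ} (hc : 0 ≤ c) :
    ∫⁻ u in Ioi c, superlevel μ f (ENNReal.ofReal u) ∂volume
      = ∫⁻ x, ENNReal.ofReal (|f x| - c) ∂μ := by
  have hm : Measurable fun x => ENNReal.ofReal (|f x| - c) := by fun_prop
  rw [lintegral_layerCake hm, ← lintegral_indicator measurableSet_Ioi,
    ← lintegral_indicator measurableSet_Ioi, ← lintegral_add_right_eq_self _ c]
  refine lintegral_congr fun u => ?_
  by_cases hu : 0 < u
  · have : c < u + c := by linarith
    simp only [indicator, mem_Ioi, this, hu, if_true, superlevel]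
    congr 1
    ext x
    simp only [mem_ofPred_eq]
    rw [← ofReal_norm, Real.norm_eq_abs, ENNReal.ofReal_lt_ofReal_iff_of_nonneg (by linarith),
      ENNReal.ofReal_lt_ofReal_iff_of_nonneg hu.le, lt_sub_iff_add_lt]
  · have : ¬ c < u + c := by linarith
    simp [indicator, this, hu]

/-- Bound $\min(t,m(u))$ by $t$ for $u\le c$ and by $m(u)$ for $u>c$. It is used with $c$ slightly
above $f^*(t)$. -/
lemma decRearrAvg_le_add (hf : Continuous f) {t : ℝ} (ht : 0 < t) {c : ℝ} (hc : 0 ≤ c) :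
    decRearrAvg μ f t
      ≤ ENNReal.ofReal c + (∫⁻ x, ENNReal.ofReal (|f x| - c) ∂μ) / ENNReal.ofReal t := by
  have ht' : ENNReal.ofReal t ≠ 0 := by simpa using ht
  rw [decRearrAvg, setLIntegral_decRearr, ← lintegral_Ioi_superlevel hf hc,
    ← Ioc_union_Ioi_eq_Ioi hc, lintegral_union measurableSet_Ioi Ioc_disjoint_Ioi_same,
    ENNReal.add_div]
  gcongr
  · rw [ENNReal.div_le_iff ht' ENNReal.ofReal_ne_top]
    calc _ ≤ ∫⁻ _ in Ioc 0 c, ENNReal.ofReal t := lintegral_mono fun u => min_le_left _ _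
      _ = _ := by simp [mul_comm]
  · exact min_le_right _ _

/-- The pointwise oscillation inequality `f^{**} - f^* ≤ C t^{1/n} |∇f|^{**}`. -/
lemma oscillation_le (hf : ContDiff ℝ 1 f) (hs : HasCompactSupport f)
    {p : ℝ≥0} (hp : NNReal.HolderConjugate (finrank ℝ E) p) {t : ℝ} (ht : 0 < t) :
    decRearrAvg μ f t - decRearr μ f t
      ≤ eLpNormLESNormFDerivOneConst μ p
        * (decRearrAvg μ (fun x => ‖fderiv ℝ f x‖) t
          * ENNReal.ofReal (t ^ (1 / (finrank ℝ E : ℝ)))) := by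
  have ht' : ENNReal.ofReal t ≠ 0 := by simpa using ht
  set n : ℝ := (finrank ℝ E : ℝ) with hn
  set C := eLpNormLESNormFDerivOneConst μ p
  have hfin := decRearr_ne_top_of_hasCompactSupport μ hf.continuous hs t
  set l : ℝ := (decRearr μ f t).toReal with hl
  have hl0 : 0 ≤ l := ENNReal.toReal_nonneg
  have hlof : ENNReal.ofReal l = decRearr μ f t := ENNReal.ofReal_toReal hfin
  have hgm : Measurable fun x => ‖fderiv ℝ f x‖ := (hf.continuous_fderiv one_ne_zero).norm.measurable
  set A : Set E := {x | decRearr μ f t < ‖f x‖ₑ}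
  have hAm : MeasurableSet A := measurableSet_lt measurable_const hf.continuous.measurable.enorm
  have hA : μ A ≤ ENNReal.ofReal t := decRearr_le_iff.1 le_rfl
  have hmemA : ∀ x, x ∉ A → |f x| ≤ l := by
    intro x hx
    have : ‖f x‖ₑ ≤ ENNReal.ofReal l := by rw [hlof]; exact not_lt.1 hx
    rw [← ofReal_norm, ENNReal.ofReal_le_ofReal_iff hl0] at this
    exact this
  rw [tsub_le_iff_left]
  refine ENNReal.le_of_forall_pos_le_add fun ε hε _ => ?_
  have hε' : (0 : ℝ) < ε := hε
  -- The jump at `l` is replaced by a ramp of width `ε`, so that the truncation is $C^1$; the price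
  -- is `ε` in the height.
  set θ : ℝ → ℝ := fun s => min 1 (max (|s| - l) 0 / ε) with hθ
  have hθc : Continuous θ := by fun_prop (disch := exact fun _ => hε'.ne')
  have hθ0 : ∀ s, 0 ≤ θ s := fun s => le_min zero_le_one (by positivity)
  have hθ1 : ∀ x, ‖θ (f x)‖ₑ ≤ A.indicator 1 x := by
    intro x
    by_cases hx : x ∈ A
    · rw [indicator_of_mem hx, ← ofReal_norm, Real.norm_of_nonneg (hθ0 _)]
      exact ENNReal.ofReal_le_one.2 (min_le_left _ _)
    · have : max (|f x| - l) 0 = 0 := max_eq_right (by linarith [hmemA x hx])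
      simp [hθ, this]
  set ψ : E → ℝ := fun x => ∫ u in (0 : ℝ)..f x, θ u with hψ
  have hψc : Continuous ψ := (contDiff_one_primitive hθc).continuous.comp hf.continuous
  have hψ1 : ∀ x, ENNReal.ofReal (|f x| - (l + ε)) ≤ ‖ψ x‖ₑ := by
    intro x
    rcases le_total (|f x|) (l + ε) with h | h
    · rw [ENNReal.ofReal_of_nonpos (by linarith)]
      exact zero_le
    · rw [← ofReal_norm]
      refine ENNReal.ofReal_le_ofReal ?_
      have := abs_intervalIntegral_ge hθc hθ0 (fun s => by simp [hθ]) (by positivity) h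
        (c := 1) (fun u hu => ?_) (le_refl |f x|)
      · simpa using this
      · have hu1 := hu.1
        refine le_min le_rfl ((one_le_div hε').2 (le_max_of_le_left ?_))
        have := le_abs_self u
        linarith
  have hψ0 : ∀ x, x ∉ A → ψ x = 0 := by
    intro x hx
    have hz : ∀ u ∈ uIcc 0 (f x), θ u = (fun _ => (0 : ℝ)) u := by
      intro u hu
      have h1 : |u| ≤ |f x| := by simpa using abs_sub_left_of_mem_uIcc (a := 0) hu
      have : max (|u| - l) 0 = 0 := max_eq_right (by linarith [hmemA x hx])
      simp [hθ, this]
    rw [hψ]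
    exact (intervalIntegral.integral_congr hz).trans (by simp)
  have hGN : eLpNorm ψ p μ ≤ C * (ENNReal.ofReal t
      * decRearrAvg μ (fun x => ‖fderiv ℝ f x‖) t) := by
    refine (eLpNorm_truncation_le μ hf hs hp hθc).trans ?_
    gcongr
    refine le_trans ?_ (setLIntegral_le_decRearrAvg hgm ht hA)
    rw [← lintegral_indicator hAm]
    refine lintegral_mono fun x => ?_
    refine (mul_le_mul_left (hθ1 x) _).trans_eq ?_
    by_cases hx : x ∈ A <;> simp [hx]
  have hp1 : 1 ≤ p := hp.symm.lt.le
  -- `ψ` lives on `A`, of measure at most $t$; Hölder costs $t^{1-1/p}=t^{1/n}$.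
  have hHol : ∫⁻ x, ‖ψ x‖ₑ ∂μ ≤ eLpNorm ψ p μ * ENNReal.ofReal (t ^ (1 / n)) := by
    have h1 : ∫⁻ x, ‖ψ x‖ₑ ∂μ = eLpNorm ψ 1 (μ.restrict A) := by
      rw [eLpNorm_one_eq_lintegral_enorm, ← lintegral_indicator hAm]
      refine lintegral_congr fun x => ?_
      by_cases hx : x ∈ A
      · simp [hx]
      · simp [hx, hψ0 x hx]
    rw [h1]
    refine (eLpNorm_le_eLpNorm_mul_rpow_measure_univ (q := p) (by exact_mod_cast hp1)
      hψc.aestronglyMeasurable).trans ?_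
    have hn1 : 1 / n = 1 - 1 / (p : ℝ) := by
      have := hp.coe.inv_add_inv_eq_one
      simp only [NNReal.coe_natCast] at this
      rw [hn, one_div, one_div]; linarith
    rw [← ENNReal.ofReal_rpow_of_pos ht]
    gcongr
    · exact Measure.restrict_le_self
    · simp only [Measure.restrict_apply_univ, ENNReal.toReal_one, ENNReal.coe_toReal, div_one, ← hn1]
      exact ENNReal.rpow_le_rpow hA (by positivity)
  refine (decRearrAvg_le_add hf.continuous ht (by positivity : 0 ≤ l + ε)).trans ?_
  rw [ENNReal.ofReal_add hl0 hε'.le, hlof, ENNReal.ofReal_coe_nnreal, add_right_comm]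
  gcongr
  rw [ENNReal.div_le_iff ht' ENNReal.ofReal_ne_top]
  calc _ ≤ ∫⁻ x, ‖ψ x‖ₑ ∂μ := lintegral_mono hψ1
    _ ≤ _ := hHol
    _ ≤ _ := mul_le_mul_left hGN _
    _ = _ := by ring

/-- The weak-type estimate on dyadic truncations. -/
lemma superlevel_rpow_le (hf : ContDiff ℝ 1 f) (hs : HasCompactSupport f)
    {p : ℝ≥0} (hp : NNReal.HolderConjugate (finrank ℝ E) p) {u : ℝ} (hu : 0 < u) :
    superlevel μ f (ENNReal.ofReal (u * 2)) ^ (1 / (p : ℝ))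
      ≤ 4 * eLpNormLESNormFDerivOneConst μ p
        * (ENNReal.ofReal u⁻¹ * ∫⁻ x in {x | u < |f x| ∧ |f x| < u * 2}, ‖fderiv ℝ f x‖ₑ ∂μ) := by
  set C := eLpNormLESNormFDerivOneConst μ p
  set A : Set E := {x | u < |f x| ∧ |f x| < u * 2}
  have hfa : Measurable fun x => |f x| := by have := hf.continuous; fun_prop
  have hAm : MeasurableSet A :=
    (measurableSet_lt measurable_const hfa).inter (measurableSet_lt hfa measurable_const)
  -- A tent over $u<|s|<2u$ of height $u/2$, so only the gradient on that layer enters.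
  set θ : ℝ → ℝ := fun s => max (min (|s| - u) (u * 2 - |s|)) 0 with hθ
  have hθc : Continuous θ := by fun_prop
  have hθ0 : ∀ s, 0 ≤ θ s := fun s => le_max_right _ _
  have hθ1 : ∀ x, ‖θ (f x)‖ₑ ≤ A.indicator (fun _ => ENNReal.ofReal (u / 2)) x := by
    intro x
    rw [← ofReal_norm, Real.norm_of_nonneg (hθ0 _)]
    by_cases hx : x ∈ A
    · rw [indicator_of_mem hx]
      refine ENNReal.ofReal_le_ofReal (max_le ?_ (by positivity))
      rcases le_total (|f x|) (u * (3 / 2)) with h | h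
      · exact (min_le_left _ _).trans (by linarith)
      · exact (min_le_right _ _).trans (by linarith)
    · rw [indicator_of_notMem hx]
      have : θ (f x) = 0 := by
        refine max_eq_right ?_
        rcases le_or_gt (|f x|) u with h | h
        · exact (min_le_left _ _).trans (by linarith)
        · have : u * 2 ≤ |f x| := not_lt.1 fun h' => hx ⟨h, h'⟩
          exact (min_le_right _ _).trans (by linarith)
      simp [this]
  set ψ : E → ℝ := fun x => ∫ u in (0 : ℝ)..f x, θ u with hψ
  have hψc : Continuous ψ := (contDiff_one_primitive hθc).continuous.comp hf.continuous
  have hψ1 : ∀ x, u * 2 ≤ |f x| → u / 4 * (u / 2) ≤ |ψ x| := by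
    intro x hx
    -- On the middle half of the layer, of length $u/2$, the tent is at least $u/4$. Hence
    -- $|\psi|\ge u^2/8$ where $|f|\ge 2u$, ready for Chebyshev.
    have := abs_intervalIntegral_ge hθc hθ0 (fun s => by simp [hθ])
      (a := u * (5 / 4)) (b := u * (7 / 4)) (c := u / 4) (s := f x) (by positivity) (by linarith)
      (fun v hv => ?_) (by linarith)
    · convert this using 2; ring
    · have h0 : 0 < v := lt_of_lt_of_le (by positivity) hv.1
      have h1 := hv.1
      have h2 := hv.2
      refine le_max_of_le_left ?_
      rw [abs_of_pos h0]
      exact le_min (by linarith) (by linarith)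
  have hGN : eLpNorm ψ p μ ≤ C * (ENNReal.ofReal (u / 2) * ∫⁻ x in A, ‖fderiv ℝ f x‖ₑ ∂μ) := by
    refine (eLpNorm_truncation_le μ hf hs hp hθc).trans ?_
    gcongr
    rw [← lintegral_const_mul' _ _ ENNReal.ofReal_ne_top, ← lintegral_indicator hAm]
    refine lintegral_mono fun x => ?_
    refine (mul_le_mul_left (hθ1 x) _).trans_eq ?_
    by_cases hx : x ∈ A <;> simp [hx]
  have hp0 : (p : ℝ≥0∞) ≠ 0 := by exact_mod_cast hp.symm.pos.ne'
  have hCh := mul_meas_ge_le_pow_eLpNorm' μ hp0 ENNReal.coe_ne_top hψc.aestronglyMeasurable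
    (ENNReal.ofReal (u / 4 * (u / 2)))
  have hp' : 0 < (p : ℝ) := by exact_mod_cast hp.symm.pos
  have hCh2 : ENNReal.ofReal (u / 4 * (u / 2))
      * superlevel μ f (ENNReal.ofReal (u * 2)) ^ (1 / (p : ℝ)) ≤ eLpNorm ψ p μ := by
    rw [← ENNReal.rpow_le_rpow_iff hp', ENNReal.mul_rpow_of_nonneg _ _ hp'.le, ← ENNReal.rpow_mul,
      one_div, inv_mul_cancel₀ hp'.ne', ENNReal.rpow_one]
    simp only [ENNReal.coe_toReal] at hCh
    refine le_trans ?_ hCh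
    gcongr
    refine measure_mono fun x hx => ?_
    have hx' : ENNReal.ofReal (u * 2) < ‖f x‖ₑ := hx
    rw [← ofReal_norm, ENNReal.ofReal_lt_ofReal_iff_of_nonneg (by positivity)] at hx'
    change ENNReal.ofReal (u / 4 * (u / 2)) ≤ ‖ψ x‖ₑ
    rw [← ofReal_norm]
    exact ENNReal.ofReal_le_ofReal (hψ1 x hx'.le)
  have h1 := hCh2.trans hGN
  -- Dividing the tent height $u/2$ by $u^2/8$ leaves $4/u$.
  have hw : ENNReal.ofReal (8 * u⁻¹ * u⁻¹) * ENNReal.ofReal (u / 4 * (u / 2)) = 1 := by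
    rw [← ENNReal.ofReal_mul (by positivity), ← ENNReal.ofReal_one]
    congr 1; field_simp; norm_num
  calc _ = ENNReal.ofReal (8 * u⁻¹ * u⁻¹) * (ENNReal.ofReal (u / 4 * (u / 2))
      * superlevel μ f (ENNReal.ofReal (u * 2)) ^ (1 / (p : ℝ))) := by
        rw [← mul_assoc, hw, one_mul]
    _ ≤ _ := mul_le_mul_right h1 _
    _ = C * (ENNReal.ofReal (8 * u⁻¹ * u⁻¹) * ENNReal.ofReal (u / 2))
        * ∫⁻ x in A, ‖fderiv ℝ f x‖ₑ ∂μ := by ring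
    _ = C * (ENNReal.ofReal 4 * ENNReal.ofReal u⁻¹) * ∫⁻ x in A, ‖fderiv ℝ f x‖ₑ ∂μ := by
        rw [← ENNReal.ofReal_mul (by positivity), ← ENNReal.ofReal_mul (by positivity)]
        congr 3; field_simp; norm_num
    _ = _ := by
        rw [show ENNReal.ofReal 4 = 4 by simp]; ring

/-- The sharp Lorentz form of the Gagliardo–Nirenberg inequality. -/
lemma lintegral_superlevel_rpow_le (hf : ContDiff ℝ 1 f) (hs : HasCompactSupport f)
    {p : ℝ≥0} (hp : NNReal.HolderConjugate (finrank ℝ E) p) :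
    ∫⁻ u in Ioi (0 : ℝ), superlevel μ f (ENNReal.ofReal u) ^ (1 / (p : ℝ))
      ≤ 8 * eLpNormLESNormFDerivOneConst μ p * ∫⁻ x, ‖fderiv ℝ f x‖ₑ ∂μ := by
  set C := eLpNormLESNormFDerivOneConst μ p
  have hm : Measurable fun t : ℝ => ENNReal.ofReal t⁻¹ :=
    ENNReal.measurable_ofReal.comp measurable_inv
  have hfa : Measurable fun x => |f x| := by have := hf.continuous; fun_prop
  have hg : Measurable fun x => ‖fderiv ℝ f x‖ₑ :=
    (hf.continuous_fderiv one_ne_zero).measurable.enorm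
  have hdil := lintegral_Ioi_comp_mul_right
    (measurable_superlevel_ofReal (μ := μ) (f := f) |>.pow_const (1 / (p : ℝ))) two_pos
  have h2 : ∫⁻ u in Ioi (0 : ℝ), superlevel μ f (ENNReal.ofReal u) ^ (1 / (p : ℝ))
      = 2 * ∫⁻ u in Ioi (0 : ℝ), superlevel μ f (ENNReal.ofReal (u * 2)) ^ (1 / (p : ℝ)) := by
    rw [hdil, ← mul_assoc, ENNReal.ofReal_inv_of_pos two_pos]
    simp [ENNReal.mul_inv_cancel]
  set Φ : ℝ × E → ℝ≥0∞ := {z : ℝ × E | z.1 < |f z.2| ∧ |f z.2| < z.1 * 2}.indicator fun z =>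
    ENNReal.ofReal z.1⁻¹ * ‖fderiv ℝ f z.2‖ₑ with hΦ
  have hΦm : Measurable Φ := by
    refine Measurable.indicator ((hm.comp measurable_fst).mul (hg.comp measurable_snd)) ?_
    exact (measurableSet_lt measurable_fst (hfa.comp measurable_snd)).inter
      (measurableSet_lt (hfa.comp measurable_snd) (measurable_fst.mul_const 2))
  have h3 : ∀ u : ℝ, ENNReal.ofReal u⁻¹
      * ∫⁻ x in {x | u < |f x| ∧ |f x| < u * 2}, ‖fderiv ℝ f x‖ₑ ∂μ = ∫⁻ x, Φ (u, x) ∂μ := by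
    intro u
    have hA : MeasurableSet {x | u < |f x| ∧ |f x| < u * 2} :=
      (measurableSet_lt measurable_const hfa).inter (measurableSet_lt hfa measurable_const)
    rw [← lintegral_const_mul' _ _ ENNReal.ofReal_ne_top, ← lintegral_indicator hA]
    rfl
  -- A point lies in the layer only for $|f|/2<u<|f|$, where $1/u\le 2/|f|$; the layers thus count
  -- each point with total weight at most 1.
  have h4 : ∀ x, ∫⁻ u in Ioi (0 : ℝ), Φ (u, x) ≤ ‖fderiv ℝ f x‖ₑ := by
    intro x
    set a := |f x|
    rcases (abs_nonneg (f x)).eq_or_lt with h0 | h0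
    · have h0 : a = 0 := h0.symm
      have : ∫⁻ u in Ioi (0 : ℝ), Φ (u, x) = ∫⁻ u in Ioi (0 : ℝ), 0 := by
        refine setLIntegral_congr_fun measurableSet_Ioi fun u hu => ?_
        have hu : 0 < u := hu
        refine indicator_of_notMem (fun h => ?_) _
        have : u < a := h.1
        linarith
      rw [this]; simp
    · have h0 : 0 < a := h0
      have hle : ∀ u ∈ Ioi (0 : ℝ), Φ (u, x) ≤ (Ioo (a / 2) a).indicator
          (fun _ => ENNReal.ofReal (2 / a) * ‖fderiv ℝ f x‖ₑ) u := by
        intro u hu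
        by_cases h : (u, x) ∈ {z : ℝ × E | z.1 < |f z.2| ∧ |f z.2| < z.1 * 2}
        · have h1 : u < a := h.1
          have h2 : a < u * 2 := h.2
          rw [indicator_of_mem (show u ∈ Ioo (a / 2) a from ⟨by linarith, h1⟩), hΦ,
            indicator_of_mem h]
          gcongr
          rw [inv_eq_one_div, div_le_div_iff₀ hu h0]
          linarith
        · rw [hΦ, indicator_of_notMem h]; exact zero_le
      calc ∫⁻ u in Ioi (0 : ℝ), Φ (u, x) ≤ ∫⁻ u in Ioi (0 : ℝ), (Ioo (a / 2) a).indicator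
              (fun _ => ENNReal.ofReal (2 / a) * ‖fderiv ℝ f x‖ₑ) u :=
            setLIntegral_mono' measurableSet_Ioi hle
        _ ≤ ∫⁻ u, (Ioo (a / 2) a).indicator
              (fun _ => ENNReal.ofReal (2 / a) * ‖fderiv ℝ f x‖ₑ) u := setLIntegral_le_lintegral _ _
        _ = ‖fderiv ℝ f x‖ₑ := by
          rw [lintegral_indicator_const measurableSet_Ioo, Real.volume_Ioo, mul_right_comm,
            ← ENNReal.ofReal_mul (by positivity)]
          have : 2 / a * (a - a / 2) = 1 := by field_simp; norm_num
          simp [this]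
  calc _ = _ := h2
    _ ≤ 2 * ∫⁻ u in Ioi (0 : ℝ), 4 * C * ∫⁻ x, Φ (u, x) ∂μ := by
        gcongr 2 * ?_
        refine setLIntegral_mono' measurableSet_Ioi fun u hu => ?_
        rw [← h3]
        exact superlevel_rpow_le hf hs hp hu
    _ = 2 * (4 * C * ∫⁻ x, ∫⁻ u in Ioi (0 : ℝ), Φ (u, x) ∂volume ∂μ) := by
        rw [lintegral_const_mul' _ _ (ENNReal.mul_ne_top (by simp) ENNReal.coe_ne_top),
          lintegral_lintegral_swap (f := fun u x => Φ (u, x)) hΦm.aemeasurable]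
    _ ≤ 2 * (4 * C * ∫⁻ x, ‖fderiv ℝ f x‖ₑ ∂μ) := by
        gcongr with x
        exact h4 x
    _ = _ := by ring

end Sobolev

/-! ### First order inequalities -/

/-- The functional `‖f^*(t) t^a‖` in `L^q(dt/t)`, i.e. the Lorentz functional of `L(1/a, q)`. -/
noncomputable def lorentzPow {α : Type*} [MeasurableSpace α] (μ : Measure α) (a : ℝ) (q : ℝ≥0∞)
    (f : α → ℝ) : ℝ≥0∞ :=
  haarNorm q fun t => decRearr μ f t * ENNReal.ofReal (t ^ a)

section LorentzPow

variable {α : Type*} [MeasurableSpace α] {μ : Measure α} {f g : α → ℝ} {a : ℝ} {q : ℝ≥0∞}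

lemma lorentzPow_mono (h : ∀ x, ‖f x‖ₑ ≤ ‖g x‖ₑ) : lorentzPow μ a q f ≤ lorentzPow μ a q g :=
  haarNorm_mono fun t _ => mul_le_mul_left (decRearr_mono h t) _

lemma lorentzPow_one_one [SFinite μ] (hf : Measurable f) :
    lorentzPow μ 1 1 f = ∫⁻ x, ‖f x‖ₑ ∂μ := by
  rw [lorentzPow, haarNorm_one, lintegral_enorm_eq_decRearr hf]
  refine setLIntegral_congr_fun measurableSet_Ioi fun t ht => ?_
  have ht : 0 < t := ht
  rw [Real.rpow_one, mul_assoc, ← ENNReal.ofReal_mul ht.le, mul_inv_cancel₀ ht.ne']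
  simp

lemma lorentzPow_sum_le (hq : 1 ≤ q) {ι : Type*} [Fintype ι] [Nonempty ι] {G : ι → α → ℝ}
    (h : ∀ x, ‖f x‖ₑ ≤ ∑ i, ‖G i x‖ₑ) :
    lorentzPow μ a q f
      ≤ ENNReal.ofReal ((Fintype.card ι : ℝ) ^ a) * ∑ i, lorentzPow μ a q (G i) := by
  set N : ℝ := (Fintype.card ι : ℝ) with hNdef
  have hN : 0 < N := by rw [hNdef]; exact_mod_cast Fintype.card_pos
  have hφ : ∀ i, Measurable fun t => decRearr μ (G i) t * ENNReal.ofReal (t ^ a) := fun i =>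
    measurable_decRearr.mul (measurable_ofReal_rpow a)
  have hφN : ∀ i, Measurable fun t =>
      decRearr μ (G i) (t * N⁻¹) * ENNReal.ofReal ((t * N⁻¹) ^ a) := fun i =>
    (hφ i).comp (measurable_mul_const N⁻¹)
  calc lorentzPow μ a q f
      ≤ haarNorm q (fun t => ENNReal.ofReal (N ^ a) *
        ∑ i, decRearr μ (G i) (t * N⁻¹) * ENNReal.ofReal ((t * N⁻¹) ^ a)) := by
        refine haarNorm_mono fun t ht => ?_
        refine (mul_le_mul_left (decRearr_sum_le h t) _).trans_eq ?_
        rw [← Finset.sum_mul, mul_left_comm, ← ENNReal.ofReal_mul (by positivity),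
          ← Real.mul_rpow hN.le (by positivity)]
        congr 3
        field_simp
    _ = ENNReal.ofReal (N ^ a) * haarNorm q (fun t =>
        ∑ i, decRearr μ (G i) (t * N⁻¹) * ENNReal.ofReal ((t * N⁻¹) ^ a)) :=
        haarNorm_const_mul hq ENNReal.ofReal_ne_top
    _ ≤ _ := by
        gcongr
        refine (haarNorm_sum_le _ hq hφN).trans (Finset.sum_le_sum fun i _ => ?_)
        -- A Dirac mass yields plain dilation invariance, which absorbs the shift from $t$ to $t/N$.
        have := haarNorm_lintegral_dilation_le hq (hφ i) (Measure.dirac N⁻¹)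
          (by rw [ae_dirac_eq]; exact inv_pos.2 hN)
        simpa only [lintegral_dirac, measure_univ, one_mul, lorentzPow] using this

end LorentzPow

section FirstOrder

variable {E : Type*} [NormedAddCommGroup E] [NormedSpace ℝ E] [MeasurableSpace E] [BorelSpace E]
  [FiniteDimensional ℝ E] (μ : Measure E) [μ.IsAddHaarMeasure]

open Module

/-- The Sobolev inequality into `L(∞,q)`. -/
lemma exists_haarNorm_oscillation_le (hn : 2 ≤ finrank ℝ E) {q : ℝ≥0∞} (hq : 1 ≤ q) :
    ∃ C : ℝ≥0, ∀ f : E → ℝ, ContDiff ℝ 1 f → HasCompactSupport f →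
      haarNorm q (fun t => decRearrAvg μ f t - decRearr μ f t)
        ≤ C * lorentzPow μ (1 / (finrank ℝ E : ℝ)) q (fun x => ‖fderiv ℝ f x‖) := by
  have hp : NNReal.HolderConjugate (finrank ℝ E) (NNReal.conjExponent (finrank ℝ E)) :=
    NNReal.HolderConjugate.conjExponent (by exact_mod_cast hn)
  set p := NNReal.conjExponent (finrank ℝ E)
  set n : ℝ := (finrank ℝ E : ℝ)
  have hn1 : 1 / n < 1 := by
    have : (2 : ℝ) ≤ n := by simp only [n]; exact_mod_cast hn
    rw [div_lt_one] <;> linarith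
  refine ⟨eLpNormLESNormFDerivOneConst μ p * (1 / (1 - 1 / n)).toNNReal, fun f hf hs => ?_⟩
  refine (haarNorm_mono fun t ht => oscillation_le hf hs hp ht).trans ?_
  rw [haarNorm_const_mul hq ENNReal.coe_ne_top, ENNReal.coe_mul, mul_assoc]
  gcongr
  exact haarNorm_hardy_avg hq measurable_decRearr hn1

/-- The Sobolev inequality in Lorentz spaces, `1 < p < n`. -/
lemma exists_lorentzPow_le_of_lt_one (hn : 2 ≤ finrank ℝ E) {q : ℝ≥0∞} (hq : 1 ≤ q) {a : ℝ}
    (ha : 1 / (finrank ℝ E : ℝ) < a) (ha1 : a < 1) :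
    ∃ C : ℝ≥0, ∀ f : E → ℝ, ContDiff ℝ 1 f → HasCompactSupport f →
      lorentzPow μ (a - 1 / (finrank ℝ E : ℝ)) q f
        ≤ C * lorentzPow μ a q (fun x => ‖fderiv ℝ f x‖) := by
  have hp : NNReal.HolderConjugate (finrank ℝ E) (NNReal.conjExponent (finrank ℝ E)) :=
    NNReal.HolderConjugate.conjExponent (by exact_mod_cast hn)
  set p := NNReal.conjExponent (finrank ℝ E)
  set n : ℝ := (finrank ℝ E : ℝ)
  have hb : 0 < a - 1 / n := by linarith
  set b := a - 1 / n
  refine ⟨(1 / b).toNNReal * (eLpNormLESNormFDerivOneConst μ p * (1 / (1 - a)).toNNReal),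
    fun f hf hs => ?_⟩
  set C := eLpNormLESNormFDerivOneConst μ p
  have hosc : Measurable fun t => decRearrAvg μ f t - decRearr μ f t :=
    measurable_decRearrAvg.sub measurable_decRearr
  -- The tail inequality needs $b=a-1/n>0$ and the averaging inequality needs $a<1$: these are the
  -- bounds $p<n$ and $p>1$.
  calc lorentzPow μ b q f
      ≤ haarNorm q (fun t => (∫⁻ s in Ioi t, (decRearrAvg μ f s - decRearr μ f s)
          * ENNReal.ofReal s⁻¹) * ENNReal.ofReal (t ^ b)) := by
        refine haarNorm_mono fun t ht => ?_
        gcongr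
        rw [← decRearrAvg_eq_lintegral_oscillation
          (fun u _ => superlevel_ne_top_of_hasCompactSupport μ hs _)
          (decRearr_ne_top_of_hasCompactSupport μ hf.continuous hs) ht]
        exact decRearr_le_avg ht
    _ ≤ ENNReal.ofReal (1 / b) * haarNorm q (fun t =>
          (decRearrAvg μ f t - decRearr μ f t) * ENNReal.ofReal (t ^ b)) :=
        haarNorm_hardy_tail hq hosc hb
    _ ≤ ENNReal.ofReal (1 / b) * haarNorm q (fun t => C
          * (decRearrAvg μ (fun x => ‖fderiv ℝ f x‖) t * ENNReal.ofReal (t ^ a))) := by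
        gcongr
        refine haarNorm_mono fun t ht => ?_
        refine (mul_le_mul_left (oscillation_le hf hs hp ht) _).trans_eq ?_
        rw [mul_assoc, mul_assoc, ← ENNReal.ofReal_mul (by positivity), ← Real.rpow_add ht]
        congr 4
        simp only [b, n]; ring
    _ = ENNReal.ofReal (1 / b) * (C * haarNorm q (fun t =>
          decRearrAvg μ (fun x => ‖fderiv ℝ f x‖) t * ENNReal.ofReal (t ^ a))) := by
        rw [haarNorm_const_mul hq ENNReal.coe_ne_top]
    _ ≤ ENNReal.ofReal (1 / b) * (C * (ENNReal.ofReal (1 / (1 - a))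
          * lorentzPow μ a q (fun x => ‖fderiv ℝ f x‖))) := by
        gcongr
        exact haarNorm_hardy_avg hq measurable_decRearr ha1
    _ = _ := by
        simp only [ENNReal.coe_mul, mul_assoc]; rfl

/-- The Sobolev inequality in Lorentz spaces, `p = q = 1`. -/
lemma exists_lorentzPow_le_one_one (hn : 2 ≤ finrank ℝ E) :
    ∃ C : ℝ≥0, ∀ f : E → ℝ, ContDiff ℝ 1 f → HasCompactSupport f →
      lorentzPow μ (1 - 1 / (finrank ℝ E : ℝ)) 1 f
        ≤ C * lorentzPow μ 1 1 (fun x => ‖fderiv ℝ f x‖) := by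
  have hp : NNReal.HolderConjugate (finrank ℝ E) (NNReal.conjExponent (finrank ℝ E)) :=
    NNReal.HolderConjugate.conjExponent (by exact_mod_cast hn)
  set p := NNReal.conjExponent (finrank ℝ E)
  have hp0 : 0 < (p : ℝ) := by exact_mod_cast hp.symm.pos
  have hn1 : 1 - 1 / (finrank ℝ E : ℝ) = 1 / (p : ℝ) := by
    have := hp.coe.inv_add_inv_eq_one
    simp only [NNReal.coe_natCast] at this
    rw [one_div, one_div]; linarith
  refine ⟨(1 / (1 / (p : ℝ))).toNNReal * (8 * eLpNormLESNormFDerivOneConst μ p),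
    fun f hf hs => ?_⟩
  have hgm : Measurable fun x => ‖fderiv ℝ f x‖ := (hf.continuous_fderiv one_ne_zero).norm.measurable
  -- Both sides become integrals without rearrangements, which avoids Hardy averaging at its
  -- forbidden exponent $a=1$.
  rw [hn1, lorentzPow_one_one hgm, lorentzPow, haarNorm_one_decRearr
    (fun u _ => superlevel_ne_top_of_hasCompactSupport μ hs _) (by positivity), ENNReal.coe_mul,
    mul_assoc]
  refine mul_le_mul_right ?_ _
  simpa using lintegral_superlevel_rpow_le hf hs hp

end FirstOrder

/-! ### Partial derivatives and iteration -/

section Euclidean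

variable {n : ℕ}

/-- The partial derivative `∂_i f`. -/
noncomputable def partialDeriv (i : Fin n) (f : EuclideanSpace ℝ (Fin n) → ℝ)
    (x : EuclideanSpace ℝ (Fin n)) : ℝ :=
  fderiv ℝ f x (EuclideanSpace.single i 1)

variable {f : EuclideanSpace ℝ (Fin n) → ℝ}

lemma contDiff_partialDeriv (hf : ContDiff ℝ ∞ f) (i : Fin n) : ContDiff ℝ ∞ (partialDeriv i f) :=
  (hf.fderiv_right (m := ∞) (by simp)).clm_apply contDiff_const

lemma hasCompactSupport_partialDeriv (hs : HasCompactSupport f) (i : Fin n) :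
    HasCompactSupport (partialDeriv i f) :=
  (hs.fderiv ℝ).comp_left (g := fun L : EuclideanSpace ℝ (Fin n) →L[ℝ] ℝ =>
    L (EuclideanSpace.single i 1)) (by simp)

lemma norm_le_sum_norm_apply_single (L : EuclideanSpace ℝ (Fin n) →L[ℝ] ℝ) :
    ‖L‖ ≤ ∑ i, ‖L (EuclideanSpace.single i 1)‖ := by
  refine L.opNorm_le_bound (by positivity) fun v => ?_
  have hv : v = ∑ i, v i • EuclideanSpace.single i (1 : ℝ) := by
    simpa using ((EuclideanSpace.basisFun (Fin n) ℝ).sum_repr v).symm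
  conv_lhs => rw [hv]
  rw [map_sum, Finset.sum_mul]
  refine norm_sum_le_of_le _ fun i _ => ?_
  rw [map_smul, norm_smul, mul_comm]
  gcongr
  exact PiLp.norm_apply_le v i

lemma enorm_norm_fderiv_le (f : EuclideanSpace ℝ (Fin n) → ℝ) (x : EuclideanSpace ℝ (Fin n)) :
    ‖‖fderiv ℝ f x‖‖ₑ ≤ ∑ i, ‖partialDeriv i f x‖ₑ := by
  rw [enorm_norm, ← ofReal_norm]
  refine (ENNReal.ofReal_le_ofReal (norm_le_sum_norm_apply_single _)).trans_eq ?_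
  rw [ENNReal.ofReal_sum_of_nonneg fun _ _ => norm_nonneg _]
  simp_rw [ofReal_norm, partialDeriv]

lemma derivLength_zero (f : EuclideanSpace ℝ (Fin n) → ℝ) (x : EuclideanSpace ℝ (Fin n)) :
    derivLength 0 f x = |f x| := by
  simp [derivLength, Real.sqrt_sq_eq_abs]

/-- The order $k$ partials of $\partial_i f$ are the order $k+1$ partials of $f$ with last index
`i`, hence `Fin.snoc`; the sum of squares is a partial sum of the full one. -/
lemma derivLength_partialDeriv_le (hf : ContDiff ℝ ∞ f) (k : ℕ) (i : Fin n)
    (x : EuclideanSpace ℝ (Fin n)) :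
    derivLength k (partialDeriv i f) x ≤ derivLength (k + 1) f x := by
  have h1 : ∀ m : Fin k → EuclideanSpace ℝ (Fin n), iteratedFDeriv ℝ k (partialDeriv i f) x m
      = iteratedFDeriv ℝ (k + 1) f x (Fin.snoc m (EuclideanSpace.single i 1)) := by
    intro m
    have hd : ContDiff ℝ k (fderiv ℝ f) := hf.fderiv_right (by exact_mod_cast le_top)
    have := (ContinuousLinearMap.apply ℝ ℝ
      (EuclideanSpace.single i (1 : ℝ))).iteratedFDeriv_comp_left (x := x) hd.contDiffAt le_rfl
    rw [iteratedFDeriv_succ_apply_right]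
    simp only [Fin.init_snoc, Fin.snoc_last]
    exact congrArg (fun M => M m) this
  have hinj : Function.Injective fun j : Fin k → Fin n => (Fin.snoc j i : Fin (k + 1) → Fin n) :=
    fun j j' h => (Fin.snoc_injective2 h).1
  refine Real.sqrt_le_sqrt ?_
  calc _ = ∑ j : Fin k → Fin n, (fun l : Fin (k + 1) → Fin n => (iteratedFDeriv ℝ (k + 1) f x
        (fun r => EuclideanSpace.single (l r) (1 : ℝ))) ^ 2) (Fin.snoc j i) := by
        refine Finset.sum_congr rfl fun j _ => ?_
        simp only
        rw [h1]
        congr 2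
        ext1 r
        refine Fin.lastCases ?_ (fun r => ?_) r <;> simp
    _ = ∑ l ∈ Finset.univ.map ⟨_, hinj⟩, (iteratedFDeriv ℝ (k + 1) f x
        (fun r => EuclideanSpace.single (l r) (1 : ℝ))) ^ 2 := by
        rw [Finset.sum_map]; rfl
    _ ≤ _ := Finset.sum_le_sum_of_subset_of_nonneg (Finset.subset_univ _)
        fun _ _ _ => sq_nonneg _

lemma enorm_derivLength_partialDeriv_le (hf : ContDiff ℝ ∞ f) (k : ℕ) (i : Fin n)
    (x : EuclideanSpace ℝ (Fin n)) :
    ‖derivLength k (partialDeriv i f) x‖ₑ ≤ ‖derivLength (k + 1) f x‖ₑ := by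
  have h0 : ∀ (k : ℕ) (g : EuclideanSpace ℝ (Fin n) → ℝ), 0 ≤ derivLength k g x :=
    fun _ _ => Real.sqrt_nonneg _
  rw [← ofReal_norm, ← ofReal_norm, Real.norm_of_nonneg (h0 _ _), Real.norm_of_nonneg (h0 _ _)]
  exact ENNReal.ofReal_le_ofReal (derivLength_partialDeriv_le hf k i x)

/-- Passing from estimates for partial derivatives to an estimate by the full gradient. -/
lemma lorentzPow_norm_fderiv_le (hn : 1 ≤ n) {q : ℝ≥0∞} (hq : 1 ≤ q) {a b : ℝ} {k : ℕ} {C : ℝ≥0}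
    (hC : ∀ f : EuclideanSpace ℝ (Fin n) → ℝ, ContDiff ℝ ∞ f → HasCompactSupport f →
      lorentzPow volume a q f ≤ C * lorentzPow volume b q (derivLength k f))
    (hf : ContDiff ℝ ∞ f) (hs : HasCompactSupport f) :
    lorentzPow volume a q (fun x => ‖fderiv ℝ f x‖)
      ≤ (((n : ℝ) ^ a).toNNReal * (n * C) : ℝ≥0)
        * lorentzPow volume b q (derivLength (k + 1) f) := by
  have : Nonempty (Fin n) := ⟨⟨0, hn⟩⟩
  calc _ ≤ ENNReal.ofReal ((Fintype.card (Fin n) : ℝ) ^ a)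
        * ∑ i, lorentzPow volume a q (partialDeriv i f) :=
        lorentzPow_sum_le hq (enorm_norm_fderiv_le f)
    _ ≤ ENNReal.ofReal ((Fintype.card (Fin n) : ℝ) ^ a)
        * ∑ _i : Fin n, C * lorentzPow volume b q (derivLength (k + 1) f) := by
        gcongr with i
        refine (hC _ (contDiff_partialDeriv hf i) (hasCompactSupport_partialDeriv hs i)).trans ?_
        gcongr
        exact lorentzPow_mono (enorm_derivLength_partialDeriv_le hf k i)
    _ = _ := by
        simp only [Finset.sum_const, Finset.card_univ, Fintype.card_fin, nsmul_eq_mul,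
          ENNReal.coe_mul, ENNReal.coe_natCast, mul_assoc]
        rfl

/-- The higher order Sobolev inequality in Lorentz spaces below the critical exponent. -/
lemma exists_lorentzPow_le_derivLength {q : ℝ≥0∞} (hq : 1 ≤ q) {a : ℝ}
    (ha : a < 1 ∨ (a = 1 ∧ q = 1)) (hn : 1 ≤ n) (k : ℕ) (hk : (k : ℝ) / n < a) :
    ∃ C : ℝ≥0, ∀ f : EuclideanSpace ℝ (Fin n) → ℝ, ContDiff ℝ ∞ f → HasCompactSupport f →
      lorentzPow volume (a - k / n) q f ≤ C * lorentzPow volume a q (derivLength k f) := by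
  have hn0 : (0 : ℝ) < n := by exact_mod_cast hn
  have hle : a ≤ 1 := by rcases ha with h | h <;> linarith
  induction k with
  | zero =>
    refine ⟨1, fun f _ _ => ?_⟩
    simp only [Nat.cast_zero, zero_div, sub_zero, ENNReal.coe_one, one_mul]
    exact lorentzPow_mono fun x => by rw [derivLength_zero, Real.enorm_abs]
  | succ k ih =>
    push_cast at hk
    rw [add_div] at hk
    have hk0 : (0 : ℝ) ≤ k / n := by positivity
    obtain ⟨C, hC⟩ := ih (by have : 0 < 1 / (n : ℝ) := by positivity
                             linarith)
    -- Room for one more subcritical step, $1/n<a\le1$, excludes dimension one.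
    have hn2 : 2 ≤ Module.finrank ℝ (EuclideanSpace ℝ (Fin n)) := by
      rw [finrank_euclideanSpace_fin]
      have : 1 / (n : ℝ) < 1 := by linarith
      rw [div_lt_one hn0] at this
      exact_mod_cast this
    have hstep : ∃ C : ℝ≥0, ∀ f : EuclideanSpace ℝ (Fin n) → ℝ, ContDiff ℝ 1 f →
        HasCompactSupport f → lorentzPow volume (a - k / n - 1 / n) q f
          ≤ C * lorentzPow volume (a - k / n) q (fun x => ‖fderiv ℝ f x‖) := by
      by_cases hlt : a - k / n < 1
      · have := exists_lorentzPow_le_of_lt_one (volume : Measure (EuclideanSpace ℝ (Fin n))) hn2 hq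
          (a := a - k / n) (by rw [finrank_euclideanSpace_fin]; linarith) hlt
        rwa [finrank_euclideanSpace_fin] at this
      -- The endpoint can occur only before any integrability is gained, so $a=1$ and the hypothesis
      -- supplies $q=1$.
      · have ha1 : a = 1 := by linarith
        have h1 : a - k / n = 1 := by linarith
        obtain rfl : q = 1 := by
          rcases ha with h | h
          · linarith
          · exact h.2
        have := exists_lorentzPow_le_one_one (volume : Measure (EuclideanSpace ℝ (Fin n))) hn2
        rw [finrank_euclideanSpace_fin] at this
        rwa [h1]
    obtain ⟨D, hD⟩ := hstep
    refine ⟨D * (((n : ℝ) ^ (a - k / n)).toNNReal * (n * C)), fun f hf hs => ?_⟩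
    have he : a - ((k + 1 : ℕ) : ℝ) / n = a - k / n - 1 / n := by push_cast; ring
    rw [he, ENNReal.coe_mul, mul_assoc]
    refine (hD f (hf.of_le (by exact_mod_cast le_top)) hs).trans ?_
    gcongr
    exact lorentzPow_norm_fderiv_le hn hq hC hf hs

/-- In dimension one the supremum norm is controlled by the `L¹` norm of the derivative. -/
lemma eLpNorm_top_le_lintegral_fderiv {f : EuclideanSpace ℝ (Fin 1) → ℝ} (hf : ContDiff ℝ 1 f)
    (hs : HasCompactSupport f) : eLpNorm f ⊤ volume ≤ ∫⁻ x, ‖fderiv ℝ f x‖ₑ := by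
  -- Pull back along the line parametrization `L`: it preserves measure for the integral, and as a
  -- closed embedding it preserves compact support.
  have hmp : MeasurePreserving (fun t : ℝ => WithLp.toLp 2 fun _ : Fin 1 => t) :=
    (PiLp.volume_preserving_toLp (Fin 1)).comp (volume_preserving_funUnique (Fin 1) ℝ).symm
  set L : ℝ → EuclideanSpace ℝ (Fin 1) := fun t => WithLp.toLp 2 fun _ : Fin 1 => t with hL
  have hLe : L = fun t : ℝ => t • EuclideanSpace.single 0 (1 : ℝ) := by
    ext t i
    fin_cases i
    simp [hL]
  have hLd : ∀ t, HasDerivAt L (EuclideanSpace.single 0 (1 : ℝ)) t := by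
    intro t
    rw [hLe]
    simpa using (hasDerivAt_id t).smul_const (EuclideanSpace.single (0 : Fin 1) (1 : ℝ))
  have hLc : ContDiff ℝ 1 L := by rw [hLe]; fun_prop
  have hLn : ∀ t, ‖L t‖ = ‖t‖ := by
    intro t; rw [hLe]; simp [norm_smul]
  have hLcl : Topology.IsClosedEmbedding L := by
    refine Isometry.isClosedEmbedding ?_
    rw [hLe]
    refine Isometry.of_dist_eq fun s t => ?_
    rw [dist_eq_norm, ← sub_smul, norm_smul, Real.dist_eq]
    simp
  have hgm : Measurable fun x => ‖fderiv ℝ f x‖ₑ :=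
    (hf.continuous_fderiv one_ne_zero).measurable.enorm
  have hpt : ∀ x, ‖f x‖ₑ ≤ ∫⁻ x, ‖fderiv ℝ f x‖ₑ := by
    intro x
    have hx : x = L (x 0) := by
      ext i
      fin_cases i
      simp [hL]
    rw [hx]
    calc ‖(f ∘ L) (x 0)‖ₑ ≤ ∫⁻ t in Iic (x 0), ‖deriv (f ∘ L) t‖ₑ :=
          HasCompactSupport.enorm_le_lintegral_Ici_deriv (hf.comp hLc)
            (hs.comp_isClosedEmbedding hLcl) _
      _ ≤ ∫⁻ t, ‖deriv (f ∘ L) t‖ₑ := setLIntegral_le_lintegral _ _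
      _ ≤ ∫⁻ t, ‖fderiv ℝ f (L t)‖ₑ := by
          refine lintegral_mono fun t => ?_
          have := (hf.differentiable one_ne_zero (L t)).hasFDerivAt.comp_hasDerivAt t (hLd t)
          rw [this.deriv]
          refine ((fderiv ℝ f (L t)).le_opENorm _).trans_eq ?_
          have : ‖EuclideanSpace.single (0 : Fin 1) (1 : ℝ)‖ₑ = 1 := by
            rw [← ofReal_norm]; simp
          rw [this, mul_one]
      _ = _ := hmp.lintegral_comp hgm
  exact essSup_le_of_ae_le _ (Filter.Eventually.of_forall hpt)

/-- The first order inequality at the critical exponent `p = n`. -/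
lemma exists_haarNorm_oscillation_le_norm_fderiv (hn : 1 ≤ n) {q : ℝ≥0∞} (hq : 1 ≤ q)
    (hnq : 2 ≤ n ∨ q = 1) :
    ∃ C : ℝ≥0, ∀ f : EuclideanSpace ℝ (Fin n) → ℝ, ContDiff ℝ ∞ f → HasCompactSupport f →
      haarNorm q (fun t => decRearrAvg volume f t - decRearr volume f t)
        ≤ C * lorentzPow volume (1 / (n : ℝ)) q (fun x => ‖fderiv ℝ f x‖) := by
  rcases hn.eq_or_lt with rfl | hn2
  · obtain rfl : q = 1 := hnq.resolve_left (by norm_num)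
    refine ⟨1, fun f hf hs => ?_⟩
    have hf1 : ContDiff ℝ 1 f := hf.of_le (by exact_mod_cast le_top)
    have hgm : Measurable fun x => ‖fderiv ℝ f x‖ :=
      (hf1.continuous_fderiv one_ne_zero).norm.measurable
    rw [haarNorm_one_oscillation (fun u _ => superlevel_ne_top_of_hasCompactSupport volume hs _)
      (decRearr_ne_top_of_hasCompactSupport volume hf.continuous hs)]
    simpa [lorentzPow_one_one hgm] using eLpNorm_top_le_lintegral_fderiv hf1 hs
  · obtain ⟨C, hC⟩ := exists_haarNorm_oscillation_le
      (volume : Measure (EuclideanSpace ℝ (Fin n)))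
      (by rwa [finrank_euclideanSpace_fin]) hq
    rw [finrank_euclideanSpace_fin] at hC
    exact ⟨C, fun f hf hs => hC f (hf.of_le (by exact_mod_cast le_top)) hs⟩

end Euclidean

/-! ### Assembly of the subcritical and critical cases -/

theorem theorem2 (n k : ℕ) (hk : 1 ≤ k) (hkn : k ≤ n)
    (p : ℝ) (hp : 1 ≤ p) (hpn : p ≤ (n : ℝ) / (k : ℝ))
    (q : ℝ≥0∞) (hq : 1 ≤ q)
    (pbar : ℝ≥0∞) (hpbar : pbar⁻¹ = ENNReal.ofReal (1 / p - (k : ℝ) / (n : ℝ)))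
    (hcase : (k < n ∧ (1 < p ∨ (p = 1 ∧ q = 1))) ∨ (k = n ∧ p = 1 ∧ q = 1)) :
    ∃ c : ℝ≥0, ∀ f : EuclideanSpace ℝ (Fin n) → ℝ, ContDiff ℝ ∞ f → HasCompactSupport f →
      lorentzNorm volume pbar q f
          ≤ c * lorentzNorm volume (ENNReal.ofReal p) q (derivLength k f) ∧
      (p = (n : ℝ) / (k : ℝ) → q = 1 →
        eLpNorm f ⊤ volume
          ≤ c * lorentzNorm volume (ENNReal.ofReal p) q (derivLength k f)) := by
  have hn : 1 ≤ n := hk.trans hkn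
  have hp0 : 0 < p := by linarith
  have hn0 : (0 : ℝ) < n := by exact_mod_cast hn
  have hk0 : (0 : ℝ) < k := by exact_mod_cast hk
  have hrhs : ∀ g : EuclideanSpace ℝ (Fin n) → ℝ,
      lorentzNorm volume (ENNReal.ofReal p) q g = lorentzPow volume (1 / p) q g := by
    intro g
    rw [lorentzNorm, if_neg ENNReal.ofReal_ne_top, ENNReal.toReal_ofReal hp0.le, lorentzPow]
  have hp1 : 1 / p < 1 ∨ (1 / p = 1 ∧ q = 1) := by
    rcases hcase with ⟨_, h | ⟨rfl, h⟩⟩ | ⟨_, rfl, h⟩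
    · exact Or.inl ((div_lt_one hp0).2 h)
    · exact Or.inr ⟨by simp, h⟩
    · exact Or.inr ⟨by simp, h⟩
  simp_rw [hrhs]
  rcases hpn.lt_or_eq with hlt | heq
  · have hkp : (k : ℝ) / n < 1 / p := by
      rw [lt_div_iff₀ hk0] at hlt
      rw [div_lt_div_iff₀ hn0 hp0]
      linarith
    obtain ⟨C, hC⟩ := exists_lorentzPow_le_derivLength hq hp1 hn k hkp
    have hpb : pbar ≠ ⊤ := by
      rintro rfl
      rw [ENNReal.inv_top, eq_comm, ENNReal.ofReal_eq_zero] at hpbar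
      linarith
    have hpbr : 1 / pbar.toReal = 1 / p - k / n := by
      rw [one_div, ← ENNReal.toReal_inv, hpbar, ENNReal.toReal_ofReal (by linarith)]
    refine ⟨C, fun f hf hs => ⟨?_, fun h => absurd h hlt.ne⟩⟩
    rw [lorentzNorm, if_neg hpb, hpbr]
    exact hC f hf hs
  · have hpk : 1 / p = k / n := by rw [heq, one_div_div]
    have hpb : pbar = ⊤ := by
      rw [hpk, sub_self, ENNReal.ofReal_zero, ENNReal.inv_eq_zero] at hpbar
      exact hpbar
    -- One derivative is kept for the critical step: after `j` subcritical steps the reciprocal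
    -- exponent is exactly $1/n$.
    obtain ⟨j, rfl⟩ : ∃ j, k = j + 1 := ⟨k - 1, by omega⟩
    have hj : 1 / p - (j : ℝ) / n = 1 / n := by rw [hpk]; push_cast; ring
    have hnq : 2 ≤ n ∨ q = 1 := by
      rcases hcase with h | h
      · left; omega
      · exact Or.inr h.2.2
    obtain ⟨C, hC⟩ := exists_lorentzPow_le_derivLength hq hp1 hn j (by
      have : 0 < 1 / (n : ℝ) := by positivity
      linarith)
    obtain ⟨D, hD⟩ := exists_haarNorm_oscillation_le_norm_fderiv hn hq hnq
    have main : ∀ f : EuclideanSpace ℝ (Fin n) → ℝ, ContDiff ℝ ∞ f → HasCompactSupport f →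
        haarNorm q (fun t => decRearrAvg volume f t - decRearr volume f t)
          ≤ (D * (((n : ℝ) ^ (1 / p - j / n)).toNNReal * (n * C)) : ℝ≥0)
            * lorentzPow volume (1 / p) q (derivLength (j + 1) f) := by
      intro f hf hs
      refine (hD f hf hs).trans ?_
      rw [ENNReal.coe_mul, mul_assoc, ← hj]
      gcongr
      exact lorentzPow_norm_fderiv_le hn hq hC hf hs
    refine ⟨D * (((n : ℝ) ^ (1 / p - j / n)).toNNReal * (n * C)), fun f hf hs => ⟨?_, ?_⟩⟩
    · rw [lorentzNorm, if_pos hpb]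
      exact main f hf hs
    -- For $q=1$ the oscillation functional is the supremum norm, so the same constant serves.
    · rintro - rfl
      rw [← haarNorm_one_oscillation
        (fun u _ => superlevel_ne_top_of_hasCompactSupport volume hs _)
        (decRearr_ne_top_of_hasCompactSupport volume hf.continuous hs)]
      exact main f hf hs
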